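/- \textbf{Theorem (Cardinality classification of a component).} Let $\mathbb{X}$ be a unimodular, locally compact, second countable Hausdorff topological group, and let $(\Omega,\mathcal{A},\mathbf{P})$ be a probability space with a $\mathbf{P}$-preserving left action $(x,\omega)\mapsto\theta_x\omega$ of $\mathbb{X}$ on $\Omega$ that is jointly measurable. Let $\mathfrak{m}$ be a simple point process on $\mathbb{X}$, i.e. a random locally finite counting measure whose atoms all have mass $1$, identified with its set of atoms. Assume that $\mathfrak{m}$ is flow-adapted, i.e. $\mathfrak{m}(\theta_x\omega,B)=\mathfrak{m}(\omega,x^{-1}B)$ for all $x\in\mathbb{X}$, $\omega\in\Omega$ and Borel $B\subseteq\mathbb{X}$, and has finite nonzero intensity, i.e. the measure $B\mapsto\mathbf{E}[\mathfrak{m}(B)]$ is locally finite and not zero. Let $H:\Omega\times\mathbb{X}\to\mathbb{X}$ be a flow-adapted point-shift on $\mathfrak{m}$, i.e. a measurable map such that $H(\theta_y\omega,yx)=yH(\omega,x)$ for all $\omega\in\Omega$ and $x,y\in\mathbb{X}$, and such that for $\mathbf{P}$-a.e. $\omega$ one has $H(\omega,X)\in\mathfrak{m}(\omega)$ for all $X\in\mathfrak{m}(\omega)$.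 We write $H(X)$ for $H(\omega,X)$ and $H^n$ for the $n$-th iterate. Let $G^H$ be the random directed graph with vertex set $\mathfrak{m}$ and an edge from each $X\in\mathfrak{m}$ to $H(X)$; its components are its undirected connected components, and its cycles are its directed cycles (a loop being a cycle of length $1$). A \emph{foil} is an equivalence class of the relation on $\mathfrak{m}$ under which $X\sim Y$ if and only if $H^n(X)=H^n(Y)$ for some $n\ge 0$. A foil $L$ has a \emph{junior foil} if there is $Y\in\mathfrak{m}$ with $H(Y)\in L$; the junior foil is then the foil of $Y$. A point is \emph{primeval} if it lies in $H^n(\mathfrak{m})$ for all $n\ge 0$, and $H^\infty(\mathfrak{m})$ is the set of primeval points. Then $\mathbf{P}$-almost surely each component $C$ of $G^H$ is in one of the following three classes. \begin{enumerate} \item \textbf{Class $\mathcal{F}/\mathcal{F}$:} $C$ is finite, and hence so is each of its foils. In this case, if $n$ is the number of foils of $C$, then $1\le n<\infty$, $C$ has a unique cycle, this cycle has length $n$, and $H^\infty(\mathfrak{m})\cap C$ is the set of vertices of this cycle. \item \textbf{Class $\mathcal{I}/\mathcal{F}$:} $C$ is infinite and each of its foils is finite. In this case $C$ is acyclic, each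 foil of $C$ has a junior foil, and $H^\infty(\mathfrak{m})\cap C$ is the set of points $\{X_n\}_{n\in\mathbb{Z}}$ of a bi-infinite path in $C$, i.e. a sequence of points of $C$ with $H(X_n)=X_{n+1}$ for all $n\in\mathbb{Z}$; this is the only bi-infinite path in $C$, up to a shift of the index. \item \textbf{Class $\mathcal{I}/\mathcal{I}$:} $C$ is infinite and all its foils are infinite. In this case $C$ is acyclic and $H^\infty(\mathfrak{m})\cap C=\emptyset$. \end{enumerate} -/

import Mathlib

open MeasureTheory
open scoped ENNReal Pointwise

/-- A locally compact group is unimodular if its modular function is identically `1`. -/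
def IsUnimodularGroup (X : Type*) [Group X] [TopologicalSpace X] [IsTopologicalGroup X]
    [LocallyCompactSpace X] : Prop :=
  ∀ x : X, Measure.modularCharacter x = 1

section PointProcesses

variable {X Ω : Type*} [MeasurableSpace X] [MeasurableSpace Ω]

/-- A simple point process on `X`: a random locally finite counting measure all of whose atoms have
mass `1`. The measurable structure on `Measure X` is the cylindrical `σ`-algebra, generated by the
evaluations at the measurable subsets of `X`. -/
structure IsSimplePointProcess [TopologicalSpace X] (m : Ω → Measure X) : Prop where
  measurable : Measurable m
  locallyFinite : ∀ ω, IsLocallyFiniteMeasure (m ω)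
  counting : ∀ ω, ∀ B : Set X, MeasurableSet B → ∃ n : ℕ∞, m ω B = (n : ℝ≥0∞)
  simple : ∀ ω, ∀ x : X, m ω {x} ≠ 0 → m ω {x} = 1

/-- The set of points (atoms) of a measure, with which a simple counting measure is identified. -/
def pointsOf (μ : Measure X) : Set X := {x | μ {x} ≠ 0}

/-- The intensity measure `B ↦ 𝐄[m(B)]` of a random measure. -/
noncomputable def intensityMeasure (P : Measure Ω) (m : Ω → Measure X) : Measure X := P.bind m

theorem intensityMeasure_apply {P : Measure Ω} {m : Ω → Measure X} (hm : Measurable m)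
    {B : Set X} (hB : MeasurableSet B) : intensityMeasure P m B = ∫⁻ ω, m ω B ∂P :=
  Measure.bind_apply hB hm.aemeasurable

/-- A point process has intensity in `(0, ∞)` if its intensity measure is locally finite and is not
the zero measure. -/
def HasFiniteNonzeroIntensity [TopologicalSpace X] (P : Measure Ω) (m : Ω → Measure X) : Prop :=
  IsLocallyFiniteMeasure (intensityMeasure P m) ∧ intensityMeasure P m ≠ 0

/-- A random measure is flow-adapted if `m(θ_x ω, B) = m(ω, x⁻¹ B)`, the flow `θ` being the
action of `X` on `Ω`. -/
def IsFlowAdapted [Group X] [MulAction X Ω] (m : Ω → Measure X) : Prop :=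
  ∀ (x : X) (ω : Ω) (B : Set X), MeasurableSet B → m (x • ω) B = m ω (x⁻¹ • B)

/-- A flow-adapted point-shift on the point process `m`. -/
structure IsFlowAdaptedPointShift [Group X] [MulAction X Ω] (P : Measure Ω) (m : Ω → Measure X)
    (H : Ω → X → X) : Prop where
  measurable : Measurable (fun p : Ω × X => H p.1 p.2)
  mapsTo : ∀ᵐ ω ∂P, ∀ x ∈ pointsOf (m ω), H ω x ∈ pointsOf (m ω)
  flowAdapted : ∀ (ω : Ω) (x y : X), H (y • ω) (y * x) = y * H ω x

end PointProcesses

section Graphs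

variable {α : Type*}

/-- The directed graph with vertex set `S` and an edge from each `x ∈ S` to `f x`. -/
def functionalGraph (S : Set α) (f : α → α) : Digraph S where
  Adj x y := f x = y

/-- The undirected connected components of `functionalGraph S f`. -/
abbrev FunctionalComponent (S : Set α) (f : α → α) : Type _ :=
  (functionalGraph S f).toSimpleGraphInclusive.ConnectedComponent

/-- The primeval points: those in the image `f^n(S)` for every `n`. -/
def primevalPoints (S : Set α) (f : α → α) : Set S :=
  {y | ∀ n : ℕ, ∃ x : S, f^[n] x = y}

/-- The foil of `x`: the points `y` of `S` with `f^n(x) = f^n(y)` for some `n`. -/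
def foil (S : Set α) (f : α → α) (x : S) : Set S :=
  {y | ∃ n : ℕ, f^[n] x = f^[n] y}

/-- The set of foils contained in `C`. -/
def foilsIn (S : Set α) (f : α → α) (C : Set S) : Set (Set S) :=
  {L | (∃ x : S, L = foil S f x) ∧ L ⊆ C}

/-- `L'` is the junior foil `L₋` of `L`: it is the foil of some `y` whose image lies in `L`. -/
def IsJuniorFoil (S : Set α) (f : α → α) (L' L : Set S) : Prop :=
  ∃ y z : S, (functionalGraph S f).Adj y z ∧ z ∈ L ∧ L' = foil S f y

/-- A directed cycle of a digraph all of whose vertices lie in `C`. It is a nonempty list of distinct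
vertices up to rotation, with an edge from each vertex to the cyclically next one; a loop at a
vertex is a cycle of length `1`. -/
def IsDirectedCycleIn {V : Type*} (G : Digraph V) (C : Set V) (c : Cycle V) : Prop :=
  c ≠ Cycle.nil ∧ c.Nodup ∧ c.Chain G.Adj ∧ ∀ x ∈ c, x ∈ C

/-- `C` contains no directed cycle (of any length `≥ 1`). -/
def IsAcyclicIn {V : Type*} (G : Digraph V) (C : Set V) : Prop :=
  ∀ c : Cycle V, ¬ IsDirectedCycleIn G C c

/-- A bi-infinite path in `C`. -/
def IsBiInfinitePathIn {V : Type*} (G : Digraph V) (C : Set V) (p : ℤ → V) : Prop :=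
  ∀ n : ℤ, p n ∈ C ∧ G.Adj (p n) (p (n + 1))

/-- Class `F/F`: the component is finite. -/
def IsClassFF (S : Set α) (f : α → α) (C : FunctionalComponent S f) : Prop :=
  C.supp.Finite

/-- Class `I/F`: the component is infinite and each of its foils is finite. -/
def IsClassIF (S : Set α) (f : α → α) (C : FunctionalComponent S f) : Prop :=
  C.supp.Infinite ∧ ∀ L ∈ foilsIn S f C.supp, L.Finite

/-- Class `I/I`: the component is infinite and all its foils are infinite. -/
def IsClassII (S : Set α) (f : α → α) (C : FunctionalComponent S f) : Prop :=
  C.supp.Infinite ∧ ∀ L ∈ foilsIn S f C.supp, L.Infinite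

/-- The structure of a component of class `F/F`: its foils are finite and finite in number, and if
`n ≥ 1` is their number, the component has a unique cycle, which has length `n` and whose vertices
are exactly the primeval points of the component. -/
def StructureFF (S : Set α) (f : α → α) (C : FunctionalComponent S f) : Prop :=
  (∀ L ∈ foilsIn S f C.supp, L.Finite) ∧
  (foilsIn S f C.supp).Finite ∧
  1 ≤ (foilsIn S f C.supp).ncard ∧
  ∃ c : Cycle S,
    IsDirectedCycleIn (functionalGraph S f) C.supp c ∧
    (∀ c' : Cycle S, IsDirectedCycleIn (functionalGraph S f) C.supp c' → c' = c) ∧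
    c.length = (foilsIn S f C.supp).ncard ∧
    primevalPoints S f ∩ C.supp = {x | x ∈ c}

/-- The structure of a component of class `I/F`: it is acyclic, each of its foils has a junior foil,
and its primeval points form a bi-infinite path, which is its only bi-infinite path up to
a shift of the index. -/
def StructureIF (S : Set α) (f : α → α) (C : FunctionalComponent S f) : Prop :=
  IsAcyclicIn (functionalGraph S f) C.supp ∧
  (∀ L ∈ foilsIn S f C.supp, ∃ L' ∈ foilsIn S f C.supp, IsJuniorFoil S f L' L) ∧
  ∃ p : ℤ → S,
    IsBiInfinitePathIn (functionalGraph S f) C.supp p ∧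
    primevalPoints S f ∩ C.supp = Set.range p ∧
    ∀ q : ℤ → S, IsBiInfinitePathIn (functionalGraph S f) C.supp q →
      ∃ k : ℤ, ∀ n : ℤ, q n = p (n + k)

/-- The structure of a component of class `I/I`: it is acyclic and has no primeval point. -/
def StructureII (S : Set α) (f : α → α) (C : FunctionalComponent S f) : Prop :=
  IsAcyclicIn (functionalGraph S f) C.supp ∧
  primevalPoints S f ∩ C.supp = ∅

end Graphs

/-! ### Orbits, foils, primeval points and cycles of a self-map. -/

section Dynamics

open Function

variable {α : Type*} {g : α → α}

/-! Probability enters only through the mass transport principle `lintegral_transport_out_eq_in`: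
for an invariant transport between the points of the process, the expected mass sent out of a set
equals the expected mass received in it. This is Fubini against Haar measure, where unimodularity
supplies right invariance and invariance under inversion.

Finite intensity gives two corollaries. If every point sends mass at most one, then every point
receives finite mass (`ae_forall_lintegral_in_lt_top`). Letting the points of a class spread unit
mass evenly over a distinguished nonempty finite subset shows that the class is finite
(`ae_measure_class_lt_top`). If moreover every point receives at least what it sends, then equality
holds (`ae_forall_lintegral_in_eq_out`).

The outcome is `HasMassTransportProperties`, valid almost surely; the rest is deterministic. In an
infinite component, a cycle, a finite foil followed by an infinite one, or a finite foil without a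
junior would each be a distinguished finite subset. So the component is acyclic, its foils are all
finite or all infinite, and finite foils have juniors.

Since fibres are finite, a primeval point has a primeval preimage. Primeval points sending unit mass
to their images thus receive at least what they send, so the map is injective on them and a foil has
at most one. In an infinite foil this single point would be a distinguished finite subset, so there
is none. If the foils are finite, compactness puts one in each, and the map permutes them, which
yields the bi-infinite path. In a finite component, the pigeonhole principle gives a cycle, which
meets each foil exactly once. -/

/-- Two points are in the same component if their forward orbits meet. -/
def SameComponent (g : α → α) (x y : α) : Prop := ∃ n k : ℕ, g^[n] x = g^[k] y

/-- Two points are in the same foil if their forward orbits meet after equally many steps. -/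
def SameFoil (g : α → α) (x y : α) : Prop := ∃ n : ℕ, g^[n] x = g^[n] y

/-- A point is primeval if it lies in the image of every iterate. -/
def IsPrimeval (g : α → α) (y : α) : Prop := ∀ n : ℕ, ∃ x, g^[n] x = y

theorem SameComponent.refl (x : α) : SameComponent g x x := ⟨0, 0, rfl⟩

theorem SameComponent.symm {x y : α} (h : SameComponent g x y) : SameComponent g y x := by
  obtain ⟨n, k, h⟩ := h
  exact ⟨k, n, h.symm⟩

theorem SameComponent.trans {x y z : α} (h : SameComponent g x y) (h' : SameComponent g y z) :
    SameComponent g x z := by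
  obtain ⟨n, k, h⟩ := h
  obtain ⟨a, b, h'⟩ := h'
  refine ⟨a + n, k + b, ?_⟩
  rw [iterate_add_apply, h, ← iterate_add_apply, add_comm a k, iterate_add_apply, h',
    ← iterate_add_apply]

theorem sameComponent_iterate (x : α) (n : ℕ) : SameComponent g (g^[n] x) x := ⟨0, n, rfl⟩

theorem SameFoil.refl (x : α) : SameFoil g x x := ⟨0, rfl⟩

theorem SameFoil.symm {x y : α} (h : SameFoil g x y) : SameFoil g y x := by
  obtain ⟨n, h⟩ := h
  exact ⟨n, h.symm⟩

theorem SameFoil.trans {x y z : α} (h : SameFoil g x y) (h' : SameFoil g y z) :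
    SameFoil g x z := by
  obtain ⟨n, h⟩ := h
  obtain ⟨a, h'⟩ := h'
  refine ⟨a + n, ?_⟩
  rw [iterate_add_apply, h, ← iterate_add_apply, add_comm a n, iterate_add_apply, h',
    ← iterate_add_apply]

theorem SameFoil.sameComponent {x y : α} (h : SameFoil g x y) : SameComponent g x y := by
  obtain ⟨n, h⟩ := h
  exact ⟨n, n, h⟩

theorem sameFoil_apply_iff {x y : α} : SameFoil g (g x) (g y) ↔ SameFoil g x y := by
  constructor
  · rintro ⟨n, h⟩
    exact ⟨n + 1, h⟩
  · rintro ⟨n, h⟩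
    refine ⟨n, ?_⟩
    rw [← iterate_succ_apply, ← iterate_succ_apply, iterate_succ_apply', h, iterate_succ_apply']

theorem sameFoil_iterate_iff {x y : α} (n : ℕ) :
    SameFoil g (g^[n] x) (g^[n] y) ↔ SameFoil g x y := by
  induction n with
  | zero => rfl
  | succ n ih => rw [iterate_succ_apply', iterate_succ_apply', sameFoil_apply_iff, ih]

/-- Whichever point needs more steps to reach the common iterate is first advanced by the
difference. -/
theorem SameComponent.exists_sameFoil {x y : α} (h : SameComponent g x y) :
    (∃ n, SameFoil g (g^[n] x) y) ∨ ∃ n, SameFoil g x (g^[n] y) := by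
  obtain ⟨n, k, h⟩ := h
  rcases le_total k n with hkn | hkn
  · refine Or.inl ⟨n - k, k, ?_⟩
    rw [← iterate_add_apply, Nat.add_sub_cancel' hkn, h]
  · refine Or.inr ⟨k - n, n, ?_⟩
    rw [← iterate_add_apply, Nat.add_sub_cancel' hkn, h]

theorem IsPrimeval.iterate {y : α} (h : IsPrimeval g y) (k : ℕ) : IsPrimeval g (g^[k] y) := by
  intro n
  obtain ⟨x, rfl⟩ := h n
  exact ⟨g^[k] x, by rw [← iterate_add_apply, ← iterate_add_apply, add_comm]⟩

theorem isPrimeval_of_mem_periodicPts {y : α} (h : y ∈ periodicPts g) : IsPrimeval g y := by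
  intro n
  obtain ⟨k, hk, hp⟩ := h
  refine ⟨g^[n * k - n] y, ?_⟩
  rw [← iterate_add_apply, Nat.add_sub_cancel' (Nat.le_mul_of_pos_right n hk)]
  exact (hp.const_mul n).eq

theorem periodicPts_iterate {y : α} (h : y ∈ periodicPts g) (n : ℕ) : g^[n] y ∈ periodicPts g := by
  obtain ⟨k, hk, hp⟩ := h
  exact ⟨k, hk, hp.apply_iterate n⟩

theorem exists_iterate_eq_of_mem_periodicPts {y : α} (h : y ∈ periodicPts g) (n : ℕ) :
    ∃ k, g^[k] (g^[n] y) = y := by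
  obtain ⟨k, hk, hp⟩ := h
  refine ⟨n * k - n, ?_⟩
  rw [← iterate_add_apply, Nat.sub_add_cancel (Nat.le_mul_of_pos_right n hk)]
  exact (hp.const_mul n).eq

/-- A periodic point is on the forward orbit of every point of its component. -/
theorem SameComponent.exists_iterate_eq {x y : α} (h : SameComponent g x y)
    (hy : y ∈ periodicPts g) : ∃ n, g^[n] x = y := by
  obtain ⟨n, k, h⟩ := h
  obtain ⟨l, hl⟩ := exists_iterate_eq_of_mem_periodicPts hy k
  exact ⟨l + n, by rw [iterate_add_apply, h, hl]⟩

theorem SameFoil.eq_of_mem_periodicPts {x y : α} (h : SameFoil g x y)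
    (hx : x ∈ periodicPts g) (hy : y ∈ periodicPts g) : x = y := by
  obtain ⟨n, h⟩ := h
  obtain ⟨a, ha, hpa⟩ := hx
  obtain ⟨b, hb, hpb⟩ := hy
  -- With the common period `a * b`, one and the same iterate undoes `g^[n]` at both points.
  have key : ∀ z, IsPeriodicPt g (a * b) z → g^[n * (a * b) - n] (g^[n] z) = z := fun z hz => by
    rw [← iterate_add_apply,
      Nat.sub_add_cancel (Nat.le_mul_of_pos_right n (Nat.mul_pos ha hb))]
    exact (hz.const_mul n).eq
  rw [← key x (hpa.mul_const b), h, key y (hpb.const_mul a)]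

/-- Cantor's intersection theorem in the discrete topology, where finite sets are compact. -/
theorem nonempty_iInter_of_antitone_finite {A : ℕ → Set α} (hA : Antitone A)
    (hfin : (A 0).Finite) (hne : ∀ n, (A n).Nonempty) : (⋂ n, A n).Nonempty := by
  let _ : TopologicalSpace α := ⊥
  have : DiscreteTopology α := ⟨rfl⟩
  exact IsCompact.nonempty_iInter_of_sequence_nonempty_isCompact_isClosed A
    (fun n => hA n.le_succ) hne hfin.isCompact fun n => isClosed_discrete _

theorem antitone_setOf_iterate_eq (s : Set α) :
    Antitone fun n : ℕ => {x | x ∈ s ∧ ∃ z, g^[n] z = x} := by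
  intro n k hnk x
  rintro ⟨hx, z, rfl⟩
  exact ⟨hx, g^[k - n] z, by rw [← iterate_add_apply, Nat.add_sub_cancel' hnk]⟩

/-- A finite set meeting the image of each iterate contains a primeval point. -/
theorem exists_isPrimeval_mem {s : Set α} (hs : s.Finite)
    (h : ∀ n : ℕ, ∃ z, g^[n] z ∈ s) : ∃ x ∈ s, IsPrimeval g x := by
  obtain ⟨x, hx⟩ := nonempty_iInter_of_antitone_finite (antitone_setOf_iterate_eq (g := g) s)
    (hs.subset fun x hx => hx.1) fun n => by
      obtain ⟨z, hz⟩ := h n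
      exact ⟨g^[n] z, hz, z, rfl⟩
  simp only [Set.mem_iInter] at hx
  exact ⟨x, (hx 0).1, fun n => (hx n).2⟩

/-- A König argument: the fibre over `y` is finite, and it meets the image of `g^[n]` because `y`
lies in the image of `g^[n + 1]`. -/
theorem IsPrimeval.exists_isPrimeval_apply_eq (hfin : ∀ y, {x | g x = y}.Finite) {y : α}
    (h : IsPrimeval g y) : ∃ x, g x = y ∧ IsPrimeval g x :=
  exists_isPrimeval_mem (hfin y) fun n => by
    obtain ⟨z, hz⟩ := h (n + 1)
    exact ⟨z, by rwa [iterate_succ_apply'] at hz⟩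

/-- The functional digraph of a self-map. -/
def mapGraph (g : α → α) : Digraph α where
  Adj x y := g x = y

/-! ### Directed cycles -/

theorem isDirectedCycleIn_periodicOrbit {y : α} (hy : y ∈ periodicPts g) :
    IsDirectedCycleIn (mapGraph g) {z | SameComponent g y z} (periodicOrbit g y) := by
  refine ⟨?_, nodup_periodicOrbit, ?_, ?_⟩
  · rw [Ne, periodicOrbit_eq_nil_iff_not_periodic_pt, not_not]
    exact hy
  · rw [periodicOrbit_chain' _ hy]
    intro n
    exact (iterate_succ_apply' g n y).symm
  · intro x hx
    obtain ⟨n, rfl⟩ := (mem_periodicOrbit_iff hy).1 hx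
    exact (sameComponent_iterate y n).symm

theorem getElem_eq_iterate_of_isChain {l : List α} (h : l.IsChain fun x y => g x = y) (n : ℕ)
    (hn : n < l.length) : l[n] = g^[n] (l[0]'(by omega)) := by
  induction n with
  | zero => rfl
  | succ n ih =>
    rw [iterate_succ_apply', ← ih (by omega)]
    exact (List.isChain_iff_getElem.1 h n hn).symm

/-- A map leaves no choice of successor, so a cycle is read off from any one of its vertices by
iteration. -/
theorem exists_eq_periodicOrbit_of_isDirectedCycleIn {C : Set α} {c : Cycle α}
    (hc : IsDirectedCycleIn (mapGraph g) C c) :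
    ∃ y ∈ C, y ∈ periodicPts g ∧ c = periodicOrbit g y := by
  obtain ⟨hnil, hnodup, hchain, hC⟩ := hc
  induction c using Quotient.inductionOn' with
  | h l =>
  cases l with
  | nil => exact absurd rfl hnil
  | cons a l =>
  have hch : (a :: (l ++ [a])).IsChain fun x y => g x = y := hchain
  have hnd : (a :: l).Nodup := hnodup
  have hget := getElem_eq_iterate_of_isChain hch
  have hper : g^[l.length + 1] a = a := by
    have := hget (l.length + 1) (by simp)
    simpa using this.symm
  have hp : a ∈ periodicPts g := ⟨l.length + 1, Nat.succ_pos _, hper⟩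
  have hget' : ∀ n (hn : n < l.length + 1), (a :: l)[n] = g^[n] a := by
    intro n hn
    rw [← List.getElem_cons_zero a (l ++ [a]) (by simp), ← hget n (by simp; omega)]
    cases n with
    | zero => rfl
    | succ n =>
      simp only [List.getElem_cons_succ]
      rw [List.getElem_append_left]
  have hmin : minimalPeriod g a = l.length + 1 := by
    refine le_antisymm (IsPeriodicPt.minimalPeriod_le (Nat.succ_pos _) hper) ?_
    -- A smaller period would make the vertex at that index equal to the vertex at index `0`,
    -- against distinctness.
    by_contra! hlt
    have hpos := minimalPeriod_pos_of_mem_periodicPts hp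
    have h0 := hget' _ hlt
    rw [iterate_minimalPeriod] at h0
    have := (hnd.getElem_inj_iff (hi := hlt) (hj := Nat.succ_pos l.length)).1 h0
    omega
  refine ⟨a, hC a ?_, hp, ?_⟩
  · exact List.mem_cons_self
  · rw [periodicOrbit_def, hmin]
    refine congrArg _ (List.ext_getElem (by simp) fun n h1 h2 => ?_)
    rw [hget' n (by simpa using h1), List.getElem_map, List.getElem_range]

theorem periodicOrbit_eq_of_sameComponent {x y : α} (h : SameComponent g x y)
    (hx : x ∈ periodicPts g) (hy : y ∈ periodicPts g) : periodicOrbit g x = periodicOrbit g y := by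
  obtain ⟨n, rfl⟩ := h.exists_iterate_eq hy
  exact (periodicOrbit_apply_iterate_eq hx n).symm

/-- All periodic points of the component lie on the orbit of `y`, hence are finitely many, and `h`
then contradicts infiniteness. -/
theorem not_mem_periodicPts_of_infinite {y : α}
    (h : {z | SameComponent g z y ∧ z ∈ periodicPts g}.Finite → {z | SameComponent g z y}.Finite)
    (hinf : {z | SameComponent g z y}.Infinite) : y ∉ periodicPts g := by
  intro hy
  refine hinf (h ((List.finite_toSet ((List.range (minimalPeriod g y)).map
    fun n => g^[n] y)).subset ?_))
  rintro z ⟨hz, hzp⟩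
  obtain ⟨n, rfl⟩ := hz.symm.exists_iterate_eq hzp
  have h1 := (mem_periodicOrbit_iff hy).2 ⟨n, rfl⟩
  rwa [periodicOrbit_def, Cycle.mem_coe_iff] at h1

end Dynamics

/-! ### Classification of the components of an abstract self-map. -/

section Dynamics

open Function

variable {α : Type*} {g : α → α}

/-! ### Finite components -/

theorem exists_mem_periodicPts_of_finite {x : α} (hfin : {y | SameComponent g x y}.Finite) :
    ∃ n, g^[n] x ∈ periodicPts g := by
  have hmaps : Set.MapsTo (fun n : ℕ => g^[n] x) Set.univ {y | SameComponent g x y} :=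
    fun n _ => (sameComponent_iterate x n).symm
  obtain ⟨a, -, b, -, hab, h⟩ := Set.infinite_univ.exists_lt_map_eq_of_mapsTo hmaps hfin
  refine ⟨a, b - a, by omega, ?_⟩
  change g^[b - a] (g^[a] x) = g^[a] x
  rw [← iterate_add_apply, Nat.sub_add_cancel hab.le]
  exact h.symm

/-- Choose for each `n` an `n`-th order preimage of `x`. Two of them, of orders `a < b`, coincide by
pigeonhole, and then `g^[b - a]` fixes `x`. -/
theorem mem_periodicPts_of_isPrimeval {x : α} (hfin : {y | SameComponent g x y}.Finite)
    (h : IsPrimeval g x) : x ∈ periodicPts g := by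
  choose z hz using h
  have hmaps : Set.MapsTo z Set.univ {y | SameComponent g x y} :=
    fun n _ => ⟨0, n, (hz n).symm⟩
  obtain ⟨a, -, b, -, hab, h⟩ := Set.infinite_univ.exists_lt_map_eq_of_mapsTo hmaps hfin
  refine ⟨b - a, by omega, ?_⟩
  change g^[b - a] x = x
  have hb := hz b
  rw [← h] at hb
  conv_lhs => rw [← hz a]
  rw [← iterate_add_apply, Nat.sub_add_cancel hab.le, hb]

/-- The foils of the component of `x`. -/
def foilsOf (g : α → α) (x : α) : Set (Set α) :=
  {L | ∃ y, SameComponent g x y ∧ L = {z | SameFoil g y z}}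

theorem foilsOf_eq_image {x y : α} (hy : y ∈ periodicPts g) (hxy : SameComponent g x y) :
    foilsOf g x = (fun u => {z | SameFoil g u z}) '' {u | u ∈ periodicOrbit g y} := by
  ext L
  constructor
  · rintro ⟨z, hz, rfl⟩
    obtain ⟨n, hn⟩ := (hz.symm.trans hxy).exists_iterate_eq hy
    -- As `z` reaches `y` in `n` steps, its foil is that of the cycle point lying `n` steps before
    -- `y`, namely `g^[k] y`.
    obtain ⟨k, hk⟩ := exists_iterate_eq_of_mem_periodicPts hy n
    refine ⟨g^[k] y, (mem_periodicOrbit_iff hy).2 ⟨k, rfl⟩, ?_⟩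
    have h : SameFoil g (g^[k] y) z :=
      ⟨n, by rw [hn, ← iterate_add_apply, add_comm, iterate_add_apply, hk]⟩
    exact Set.ext fun w => ⟨fun hw => h.symm.trans hw, fun hw => h.trans hw⟩
  · rintro ⟨u, hu, rfl⟩
    obtain ⟨n, rfl⟩ := (mem_periodicOrbit_iff hy).1 hu
    exact ⟨_, hxy.trans (sameComponent_iterate y n).symm, rfl⟩

/-- Distinct periodic points have distinct foils, so the foils are counted by the points of the
cycle. -/
theorem foilsOf_finite_and_ncard {x y : α} (hy : y ∈ periodicPts g) (hxy : SameComponent g x y) :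
    (foilsOf g x).Finite ∧ (foilsOf g x).ncard = minimalPeriod g y := by
  classical
  have himage := foilsOf_eq_image hy hxy
  have hset : {u | u ∈ periodicOrbit g y} =
      (((List.range (minimalPeriod g y)).map fun n => g^[n] y).toFinset : Set α) := by
    ext u
    rw [Set.mem_ofPred_eq, periodicOrbit_def, Cycle.mem_coe_iff, Finset.mem_coe, List.mem_toFinset]
  have hinj : Set.InjOn (fun u => {z | SameFoil g u z}) {u | u ∈ periodicOrbit g y} := by
    intro u hu v hv huv
    obtain ⟨n, rfl⟩ := (mem_periodicOrbit_iff hy).1 hu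
    obtain ⟨k, rfl⟩ := (mem_periodicOrbit_iff hy).1 hv
    have h : g^[k] y ∈ {z | SameFoil g (g^[n] y) z} := by
      rw [show {z | SameFoil g (g^[n] y) z} = {z | SameFoil g (g^[k] y) z} from huv]
      exact SameFoil.refl _
    exact SameFoil.eq_of_mem_periodicPts h (periodicPts_iterate hy n) (periodicPts_iterate hy k)
  constructor
  · rw [himage, hset]
    exact (Finset.finite_toSet _).image _
  · have hnodup : (periodicOrbit g y).Nodup := nodup_periodicOrbit
    rw [periodicOrbit_def, Cycle.nodup_coe_iff] at hnodup
    rw [himage, hinj.ncard_image, hset, Set.ncard_coe_finset,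
      List.toFinset_card_of_nodup hnodup, List.length_map, List.length_range]

/-- The structure of a finite component. -/
theorem structure_of_finite {x : α} (hfin : {y | SameComponent g x y}.Finite) :
    (∀ L ∈ foilsOf g x, L.Finite) ∧ (foilsOf g x).Finite ∧ 1 ≤ (foilsOf g x).ncard ∧
    ∃ c : Cycle α, IsDirectedCycleIn (mapGraph g) {y | SameComponent g x y} c ∧
      (∀ c' : Cycle α, IsDirectedCycleIn (mapGraph g) {y | SameComponent g x y} c' → c' = c) ∧
      c.length = (foilsOf g x).ncard ∧
      {y | IsPrimeval g y} ∩ {y | SameComponent g x y} = {y | y ∈ c} := by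
  obtain ⟨n, hy⟩ := exists_mem_periodicPts_of_finite hfin
  have hxy : SameComponent g x (g^[n] x) := (sameComponent_iterate x n).symm
  generalize g^[n] x = y at hy hxy
  have hC : {z | SameComponent g x z} = {z | SameComponent g y z} :=
    Set.ext fun z => ⟨fun h => hxy.symm.trans h, fun h => hxy.trans h⟩
  obtain ⟨hffin, hcard⟩ := foilsOf_finite_and_ncard hy hxy
  refine ⟨?_, hffin, ?_, periodicOrbit g y, ?_, ?_, ?_, ?_⟩
  · rintro L ⟨z, hz, rfl⟩
    exact hfin.subset fun w hw => hz.trans (SameFoil.sameComponent hw)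
  · rw [hcard]
    exact minimalPeriod_pos_of_mem_periodicPts hy
  · rw [hC]
    exact isDirectedCycleIn_periodicOrbit hy
  · intro c' hc'
    obtain ⟨z, hz, hzp, rfl⟩ := exists_eq_periodicOrbit_of_isDirectedCycleIn hc'
    exact periodicOrbit_eq_of_sameComponent (SameComponent.trans (SameComponent.symm hz) hxy) hzp hy
  · rw [hcard, periodicOrbit_length]
  · ext z
    constructor
    · rintro ⟨hz, hxz⟩
      have hzp : z ∈ periodicPts g := mem_periodicPts_of_isPrimeval
        (hfin.subset fun w hw => SameComponent.trans hxz hw) hz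
      obtain ⟨k, hk⟩ := (hxy.symm.trans hxz).exists_iterate_eq hzp
      exact (mem_periodicOrbit_iff hy).2 ⟨k, hk⟩
    · intro hz
      obtain ⟨k, rfl⟩ := (mem_periodicOrbit_iff hy).1 hz
      exact ⟨isPrimeval_of_mem_periodicPts (periodicPts_iterate hy k),
        hxy.trans (sameComponent_iterate y k).symm⟩

/-! ### Infinite components -/

/-- The last finite foil: `y` has a finite foil and its image has an infinite one. -/
def InLastFiniteFoil (g : α → α) (y : α) : Prop :=
  {z | SameFoil g z y}.Finite ∧ ¬ {z | SameFoil g z (g y)}.Finite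

/-- The youngest foil: `y` has a finite foil, which contains no image. -/
def InYoungestFiniteFoil (g : α → α) (y : α) : Prop :=
  {z | SameFoil g z y}.Finite ∧ ¬ ∃ z, SameFoil g (g z) y

/-- The combinatorial consequences of mass transport for the self-map of a point process:
preimages are finite, an infinite component or foil has no distinguished nonempty finite subset,
and the map is injective on primeval points. -/
structure HasMassTransportProperties (g : α → α) : Prop where
  finite_preimage : ∀ y, {x | g x = y}.Finite
  periodic : ∀ y ∈ periodicPts g, {z | SameComponent g z y ∧ z ∈ periodicPts g}.Finite →
    {z | SameComponent g z y}.Finite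
  lastFinite : ∀ y, InLastFiniteFoil g y → {z | SameComponent g z y ∧ InLastFiniteFoil g z}.Finite →
    {z | SameComponent g z y}.Finite
  youngestFinite : ∀ y, InYoungestFiniteFoil g y →
    {z | SameComponent g z y ∧ InYoungestFiniteFoil g z}.Finite → {z | SameComponent g z y}.Finite
  primeval_injective : ∀ x y, IsPrimeval g x → IsPrimeval g y → g x = g y → x = y
  primeval_foil : ∀ y, IsPrimeval g y → {z | SameFoil g z y ∧ IsPrimeval g z}.Finite →
    {z | SameFoil g z y}.Finite

/-- The foil of `x` is covered by the fibres over the foil of `g x`, a finite union of finite sets.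
-/
theorem finite_foil_of_apply (hg : ∀ y, {x | g x = y}.Finite) {x : α}
    (h : {z | SameFoil g z (g x)}.Finite) : {z | SameFoil g z x}.Finite :=
  (h.biUnion fun y _ => hg y).subset fun z hz =>
    Set.mem_biUnion (x := g z) (show SameFoil g (g z) (g x) from sameFoil_apply_iff.2 hz) rfl

theorem finite_foil_of_iterate (hg : ∀ y, {x | g x = y}.Finite) {x : α} (n : ℕ)
    (h : {z | SameFoil g z (g^[n] x)}.Finite) : {z | SameFoil g z x}.Finite := by
  induction n with
  | zero => exact h
  | succ n ih =>
    rw [iterate_succ_apply'] at h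
    exact ih (finite_foil_of_apply hg h)

theorem SameFoil.finite_foil {x y : α} (h : SameFoil g x y) (hy : {z | SameFoil g z y}.Finite) :
    {z | SameFoil g z x}.Finite :=
  hy.subset fun _ hz => SameFoil.trans hz h

/-- A component has at most one last finite foil: if `y` were strictly ahead of `x`, finiteness of
its foil would pull back to the foil of `g x`. -/
theorem SameFoil.of_inLastFiniteFoil (hg : ∀ y, {x | g x = y}.Finite) {x y : α}
    (hx : InLastFiniteFoil g x) (hy : InLastFiniteFoil g y) {n : ℕ}
    (h : SameFoil g (g^[n] x) y) : SameFoil g x y := by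
  cases n with
  | zero => exact h
  | succ n => exact absurd (finite_foil_of_iterate hg n (h.finite_foil hy.1)) hx.2

theorem SameFoil.of_inYoungestFiniteFoil {x y : α} (hy : InYoungestFiniteFoil g y) {n : ℕ}
    (h : SameFoil g (g^[n] x) y) : SameFoil g x y := by
  cases n with
  | zero => exact h
  | succ n =>
    rw [iterate_succ_apply'] at h
    exact absurd ⟨_, h⟩ hy.2

namespace HasMassTransportProperties

theorem not_mem_periodicPts (hg : HasMassTransportProperties g) {x y : α}
    (hinf : {z | SameComponent g x z}.Infinite) (hy : SameComponent g x y) :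
    y ∉ periodicPts g := fun hyp =>
  not_mem_periodicPts_of_infinite (hg.periodic y hyp)
    (hinf.mono fun _ hz => SameComponent.trans (SameComponent.symm hz) hy) hyp

theorem isAcyclicIn (hg : HasMassTransportProperties g) {x : α}
    (hinf : {z | SameComponent g x z}.Infinite) :
    IsAcyclicIn (mapGraph g) {z | SameComponent g x z} := by
  intro c hc
  obtain ⟨y, hy, hyp, -⟩ := exists_eq_periodicOrbit_of_isDirectedCycleIn hc
  exact hg.not_mem_periodicPts hinf hy hyp

theorem infinite_setOf_symm {x y : α} (hinf : {z | SameComponent g x z}.Infinite)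
    (hy : SameComponent g x y) : {z | SameComponent g z y}.Infinite :=
  hinf.mono fun _ hz => SameComponent.trans (SameComponent.symm hz) hy

theorem not_inLastFiniteFoil (hg : HasMassTransportProperties g) {x y : α}
    (hinf : {z | SameComponent g x z}.Infinite) (hy : SameComponent g x y) :
    ¬ InLastFiniteFoil g y := by
  intro h
  refine infinite_setOf_symm hinf hy (hg.lastFinite y h (h.1.subset ?_))
  rintro z ⟨hzy, hz⟩
  rcases hzy.exists_sameFoil with ⟨n, hn⟩ | ⟨n, hn⟩
  · exact hn.of_inLastFiniteFoil hg.finite_preimage hz h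
  · exact (hn.symm.of_inLastFiniteFoil hg.finite_preimage h hz).symm

/-- All youngest points of the component lie in the single finite foil of `y`, so they would form a
distinguished finite subset. -/
theorem not_inYoungestFiniteFoil (hg : HasMassTransportProperties g) {x y : α}
    (hinf : {z | SameComponent g x z}.Infinite) (hy : SameComponent g x y) :
    ¬ InYoungestFiniteFoil g y := by
  intro h
  refine infinite_setOf_symm hinf hy (hg.youngestFinite y h (h.1.subset ?_))
  rintro z ⟨hzy, hz⟩
  rcases hzy.exists_sameFoil with ⟨n, hn⟩ | ⟨n, hn⟩
  · exact hn.of_inYoungestFiniteFoil h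
  · exact (hn.symm.of_inYoungestFiniteFoil hz).symm

/-- Finiteness of foils passes backwards because fibres are finite, and forwards because there is no
last finite foil. -/
theorem finite_foil_iterate_iff (hg : HasMassTransportProperties g) {x y : α}
    (hinf : {z | SameComponent g x z}.Infinite) (hy : SameComponent g x y) (n : ℕ) :
    {z | SameFoil g z (g^[n] y)}.Finite ↔ {z | SameFoil g z y}.Finite := by
  refine ⟨finite_foil_of_iterate hg.finite_preimage n, fun h => ?_⟩
  induction n with
  | zero => exact h
  | succ n ih =>
    by_contra hn
    rw [iterate_succ_apply'] at hn
    exact hg.not_inLastFiniteFoil hinf (hy.trans (sameComponent_iterate y n).symm) ⟨ih, hn⟩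

theorem finite_foil_iff (hg : HasMassTransportProperties g) {x y : α}
    (hinf : {z | SameComponent g x z}.Infinite) (hy : SameComponent g x y) :
    {z | SameFoil g z x}.Finite ↔ {z | SameFoil g z y}.Finite := by
  have hxy := hy
  obtain ⟨n, k, h⟩ := hy
  rw [← hg.finite_foil_iterate_iff hinf (SameComponent.refl x) n, h,
    hg.finite_foil_iterate_iff hinf hxy k]

theorem setOf_sameFoil_comm (y : α) : {z | SameFoil g y z} = {z | SameFoil g z y} :=
  Set.ext fun _ => ⟨SameFoil.symm, SameFoil.symm⟩

theorem foils_finite_or_infinite (hg : HasMassTransportProperties g) {x : α}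
    (hinf : {z | SameComponent g x z}.Infinite) :
    (∀ L ∈ foilsOf g x, L.Finite) ∨ ∀ L ∈ foilsOf g x, L.Infinite := by
  by_cases h : {z | SameFoil g z x}.Finite
  · refine Or.inl ?_
    rintro L ⟨y, hy, rfl⟩
    rw [setOf_sameFoil_comm]
    exact (hg.finite_foil_iff hinf hy).1 h
  · refine Or.inr ?_
    rintro L ⟨y, hy, rfl⟩
    rw [setOf_sameFoil_comm]
    exact fun h' => h ((hg.finite_foil_iff hinf hy).2 h')

theorem exists_apply_sameFoil (hg : HasMassTransportProperties g) {x y : α}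
    (hinf : {z | SameComponent g x z}.Infinite) (hfin : ∀ L ∈ foilsOf g x, L.Finite)
    (hy : SameComponent g x y) : ∃ z, SameFoil g (g z) y := by
  by_contra h
  refine hg.not_inYoungestFiniteFoil hinf hy ⟨?_, h⟩
  rw [← setOf_sameFoil_comm]
  exact hfin _ ⟨y, hy, rfl⟩

theorem exists_iterate_sameFoil (hg : HasMassTransportProperties g) {x y : α}
    (hinf : {z | SameComponent g x z}.Infinite) (hfin : ∀ L ∈ foilsOf g x, L.Finite)
    (hy : SameComponent g x y) (n : ℕ) : ∃ z, SameFoil g (g^[n] z) y := by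
  induction n with
  | zero => exact ⟨y, SameFoil.refl y⟩
  | succ n ih =>
    obtain ⟨z, hz⟩ := ih
    obtain ⟨w, hw⟩ := hg.exists_apply_sameFoil hinf hfin
      (hy.trans (hz.sameComponent.symm.trans (sameComponent_iterate z n)))
    exact ⟨w, ((sameFoil_iterate_iff n).2 hw).trans hz⟩

/-- Descending through junior foils shows that the finite foil meets the image of every iterate;
compactness does the rest. -/
theorem exists_isPrimeval_sameFoil (hg : HasMassTransportProperties g) {x y : α}
    (hinf : {z | SameComponent g x z}.Infinite) (hfin : ∀ L ∈ foilsOf g x, L.Finite)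
    (hy : SameComponent g x y) : ∃ z, SameFoil g y z ∧ IsPrimeval g z :=
  exists_isPrimeval_mem (hfin _ ⟨y, hy, rfl⟩) fun n => by
    obtain ⟨z, hz⟩ := hg.exists_iterate_sameFoil hinf hfin hy n
    exact ⟨z, hz.symm⟩

/-- Iterates of primeval points are primeval, so injectivity can be applied backwards from the
meeting point, one step at a time. -/
theorem eq_of_sameFoil (hg : HasMassTransportProperties g) {x y : α} (hx : IsPrimeval g x)
    (hy : IsPrimeval g y) (h : SameFoil g x y) : x = y := by
  obtain ⟨n, h⟩ := h
  induction n with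
  | zero => exact h
  | succ n ih =>
    rw [iterate_succ_apply', iterate_succ_apply'] at h
    exact ih (hg.primeval_injective _ _ (hx.iterate n) (hy.iterate n) h)

/-- An infinite component with infinite foils has no primeval point. -/
theorem not_isPrimeval (hg : HasMassTransportProperties g) {x y : α}
    (hinf : ∀ L ∈ foilsOf g x, L.Infinite) (hy : SameComponent g x y) : ¬ IsPrimeval g y := by
  intro h
  refine hinf _ ⟨y, hy, rfl⟩ ?_
  rw [setOf_sameFoil_comm]
  refine hg.primeval_foil y h ((Set.finite_singleton y).subset ?_)
  rintro z ⟨hzy, hz⟩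
  exact hg.eq_of_sameFoil hz h hzy

/-- Injectivity comes from mass transport, surjectivity from finiteness of the fibres. Invertibility
is what allows paths indexed by `ℤ`. -/
theorem bijective_primeval (hg : HasMassTransportProperties g) :
    Bijective fun x : {y // IsPrimeval g y} => (⟨g x, x.2.iterate 1⟩ : {y // IsPrimeval g y}) := by
  constructor
  · intro x y h
    exact Subtype.ext (hg.primeval_injective _ _ x.2 y.2 (congrArg Subtype.val h))
  · intro y
    obtain ⟨x, hxy, hx⟩ := y.2.exists_isPrimeval_apply_eq hg.finite_preimage
    exact ⟨⟨x, hx⟩, Subtype.ext hxy⟩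

/-- The permutation of the primeval points induced by the map. -/
noncomputable def primevalPerm (hg : HasMassTransportProperties g) :
    Equiv.Perm {y // IsPrimeval g y} :=
  Equiv.ofBijective _ hg.bijective_primeval

theorem coe_primevalPerm_apply (hg : HasMassTransportProperties g) (x : {y // IsPrimeval g y}) :
    (hg.primevalPerm x : α) = g x := rfl

theorem coe_primevalPerm_pow_apply (hg : HasMassTransportProperties g)
    (x : {y // IsPrimeval g y}) (n : ℕ) : ((hg.primevalPerm ^ n) x : α) = g^[n] x := by
  induction n with
  | zero => rfl
  | succ n ih =>
    rw [pow_succ', Equiv.Perm.mul_apply, coe_primevalPerm_apply, ih, iterate_succ_apply']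

theorem _root_.IsBiInfinitePathIn.isPrimeval {C : Set α} {q : ℤ → α}
    (hq : IsBiInfinitePathIn (mapGraph g) C q) (k : ℤ) : IsPrimeval g (q k) := by
  intro n
  refine ⟨q (k - n), ?_⟩
  have h : ∀ j : ℕ, g^[j] (q (k - n)) = q (k - n + j) := by
    intro j
    induction j with
    | zero => simp
    | succ j ih =>
      rw [iterate_succ_apply', ih, Nat.cast_succ, ← add_assoc]
      exact (hq _).2
  rw [h n, sub_add_cancel]

/-- The primeval points of an infinite component with finite foils. -/
theorem exists_biInfinitePath (hg : HasMassTransportProperties g) {x : α}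
    (hinf : {z | SameComponent g x z}.Infinite) (hfin : ∀ L ∈ foilsOf g x, L.Finite) :
    ∃ p : ℤ → α, IsBiInfinitePathIn (mapGraph g) {z | SameComponent g x z} p ∧
      {y | IsPrimeval g y} ∩ {y | SameComponent g x y} = Set.range p ∧
      ∀ q : ℤ → α, IsBiInfinitePathIn (mapGraph g) {z | SameComponent g x z} q →
        ∃ k : ℤ, ∀ n : ℤ, q n = p (n + k) := by
  obtain ⟨y, hxy, hy⟩ := hg.exists_isPrimeval_sameFoil hinf hfin (SameComponent.refl x)
  set e := hg.primevalPerm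
  have hadj : ∀ (z : {y // IsPrimeval g y}) (n : ℤ), g ((e ^ n) z) = (e ^ (n + 1)) z := by
    intro z n
    rw [add_comm, zpow_add, zpow_one, Equiv.Perm.mul_apply, coe_primevalPerm_apply]
  have hcomp : ∀ n : ℤ, SameComponent g x ((e ^ n) ⟨y, hy⟩) := by
    intro n
    induction n using Int.induction_on with
    | zero => exact hxy.sameComponent
    | succ n ih =>
      rw [← hadj]
      exact ih.trans (sameComponent_iterate _ 1).symm
    | pred n ih =>
      rw [← sub_add_cancel (-(n : ℤ)) 1, ← hadj] at ih
      exact ih.trans (sameComponent_iterate _ 1)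
  have hrange : {y | IsPrimeval g y} ∩ {y | SameComponent g x y} =
      Set.range fun n : ℤ => ((e ^ n) ⟨y, hy⟩ : α) := by
    ext z
    constructor
    · rintro ⟨hz, hxz⟩
      rcases (hxy.sameComponent.symm.trans hxz).exists_sameFoil with ⟨n, hn⟩ | ⟨n, hn⟩
      · refine ⟨n, ?_⟩
        have h := hg.eq_of_sameFoil (hy.iterate n) hz hn
        simpa only [zpow_natCast, e, coe_primevalPerm_pow_apply] using h
      · refine ⟨-n, ?_⟩
        have h := hg.eq_of_sameFoil hy (hz.iterate n) hn
        have h' : (⟨y, hy⟩ : {y // IsPrimeval g y}) = (e ^ n) ⟨z, hz⟩ :=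
          Subtype.ext (by simpa only [e, coe_primevalPerm_pow_apply] using h)
        simp only [h', zpow_neg, zpow_natCast]
        rw [← Equiv.Perm.mul_apply, inv_mul_cancel, Equiv.Perm.one_apply]
    · rintro ⟨n, rfl⟩
      exact ⟨((e ^ n) ⟨y, hy⟩).2, hcomp n⟩
  refine ⟨fun n => (e ^ n) ⟨y, hy⟩, fun n => ⟨hcomp n, hadj _ n⟩, hrange, ?_⟩
  intro q hq
  have h0 : q 0 ∈ {y | IsPrimeval g y} ∩ {y | SameComponent g x y} := ⟨hq.isPrimeval 0, (hq 0).1⟩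
  rw [hrange] at h0
  obtain ⟨k, hk⟩ := h0
  refine ⟨k, fun n => ?_⟩
  induction n using Int.induction_on with
  | zero => simp only [zero_add, ← hk]
  | succ n ih =>
    rw [← (hq n).2, ih, hadj, add_right_comm]
  -- Going backwards, the predecessor is determined only because both candidates are primeval.
  | pred n ih =>
    refine hg.primeval_injective _ _ (hq.isPrimeval _) (Subtype.property _) ?_
    rw [hadj, (hq _).2, sub_add_cancel, ih, sub_add_eq_add_sub, sub_add_cancel]

end HasMassTransportProperties

end Dynamics

/-! ### From the graph on a subset to the restricted self-map. -/

section Components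

open Function

variable {α : Type*} {S : Set α} {f : α → α}

theorem coe_iterate_eq_iff (hf : Set.MapsTo f S S) {x y : S} {n k : ℕ} :
    (hf.restrict f S S)^[n] x = (hf.restrict f S S)^[k] y ↔ f^[n] x = f^[k] y := by
  rw [← Subtype.coe_inj, hf.coe_iterate_restrict, hf.coe_iterate_restrict]

theorem sameComponent_restrict_iff (hf : Set.MapsTo f S S)
    (x y : S) : SameComponent (hf.restrict f S S) x y ↔ SameComponent f x y :=
  exists_congr fun _ => exists_congr fun _ => coe_iterate_eq_iff hf

theorem sameFoil_restrict_iff (hf : Set.MapsTo f S S)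
    (x y : S) : SameFoil (hf.restrict f S S) x y ↔ SameFoil f x y :=
  exists_congr fun _ => coe_iterate_eq_iff hf

theorem mem_periodicPts_restrict_iff (hf : Set.MapsTo f S S)
    (x : S) : x ∈ periodicPts (hf.restrict f S S) ↔ ∃ n, f^[n + 1] x = x := by
  constructor
  · rintro ⟨n, hn, h⟩
    refine ⟨n - 1, ?_⟩
    rw [Nat.sub_add_cancel hn]
    exact (coe_iterate_eq_iff hf (k := 0)).1 h
  · rintro ⟨n, h⟩
    exact ⟨n + 1, n.succ_pos, (coe_iterate_eq_iff hf (k := 0)).2 h⟩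

theorem functionalGraph_eq_mapGraph (hf : Set.MapsTo f S S) :
    functionalGraph S f = mapGraph (hf.restrict f S S) := by
  ext x y
  change f x = y ↔ hf.restrict f S S x = y
  rw [← Subtype.coe_inj, hf.val_restrict_apply]

theorem foil_eq (hf : Set.MapsTo f S S) (x : S) :
    foil S f x = {y | SameFoil (hf.restrict f S S) x y} :=
  Set.ext fun _ => exists_congr fun _ => (coe_iterate_eq_iff hf).symm

theorem primevalPoints_eq (hf : Set.MapsTo f S S) :
    primevalPoints S f = {y | IsPrimeval (hf.restrict f S S) y} :=
  Set.ext fun _ => forall_congr' fun _ => exists_congr fun _ =>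
    (coe_iterate_eq_iff (k := 0) hf).symm

theorem reachable_iff (hf : Set.MapsTo f S S) {x y : S} :
    (functionalGraph S f).toSimpleGraphInclusive.Reachable x y ↔
      SameComponent (hf.restrict f S S) x y := by
  rw [functionalGraph_eq_mapGraph hf]
  set g := hf.restrict f S S
  have hiter : ∀ (z : S) (n : ℕ), (mapGraph g).toSimpleGraphInclusive.Reachable z (g^[n] z) := by
    intro z n
    induction n with
    | zero => exact SimpleGraph.Reachable.refl _
    | succ n ih =>
      refine ih.trans ?_
      rw [iterate_succ_apply']
      -- A simple graph has no loops, so a fixed point contributes no edge and is handled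
      -- separately.
      by_cases h : g^[n] z = g (g^[n] z)
      · rw [← h]
      · exact SimpleGraph.Adj.reachable ((SimpleGraph.fromRel_adj _ _ _).2 ⟨h, Or.inl rfl⟩)
  constructor
  · rintro ⟨w⟩
    induction w with
    | nil => exact SameComponent.refl _
    | cons h _ ih =>
      refine SameComponent.trans ?_ ih
      rcases ((SimpleGraph.fromRel_adj _ _ _).1 h).2 with h | h
      · exact ⟨1, 0, h⟩
      · exact ⟨0, 1, h.symm⟩
  · rintro ⟨n, k, h⟩
    exact (hiter x n).trans (h ▸ (hiter y k).symm)

theorem supp_eq (hf : Set.MapsTo f S S) (x : S) :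
    ((functionalGraph S f).toSimpleGraphInclusive.connectedComponentMk x).supp =
      {y | SameComponent (hf.restrict f S S) x y} := by
  ext y
  rw [SimpleGraph.ConnectedComponent.mem_supp_iff, SimpleGraph.ConnectedComponent.eq,
    reachable_iff hf]
  exact ⟨SameComponent.symm, SameComponent.symm⟩

theorem foilsIn_eq (hf : Set.MapsTo f S S) (x : S) :
    foilsIn S f {y | SameComponent (hf.restrict f S S) x y} =
      foilsOf (hf.restrict f S S) x := by
  ext L
  constructor
  · rintro ⟨⟨y, rfl⟩, hL⟩
    rw [foil_eq hf] at hL ⊢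
    exact ⟨y, hL (SameFoil.refl y), rfl⟩
  · rintro ⟨y, hy, rfl⟩
    exact ⟨⟨y, (foil_eq hf y).symm⟩, fun z hz => hy.trans (SameFoil.sameComponent hz)⟩

/-- The classification of the components of a functional graph satisfying the consequences of
mass transport. -/
theorem HasMassTransportProperties.classification (hf : Set.MapsTo f S S)
    (hg : HasMassTransportProperties (hf.restrict f S S)) (C : FunctionalComponent S f) :
    (IsClassFF S f C ∨ IsClassIF S f C ∨ IsClassII S f C) ∧
      (IsClassFF S f C → StructureFF S f C) ∧ (IsClassIF S f C → StructureIF S f C) ∧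
      (IsClassII S f C → StructureII S f C) := by
  induction C using SimpleGraph.ConnectedComponent.ind with
  | h x =>
  unfold IsClassFF IsClassIF IsClassII StructureFF StructureIF StructureII
  rw [supp_eq hf, foilsIn_eq hf, primevalPoints_eq hf, functionalGraph_eq_mapGraph hf]
  refine ⟨?_, structure_of_finite, ?_, ?_⟩
  · by_cases h : {y | SameComponent (hf.restrict f S S) x y}.Finite
    · exact Or.inl h
    · exact Or.inr ((hg.foils_finite_or_infinite h).imp (fun h' => ⟨h, h'⟩) fun h' => ⟨h, h'⟩)
  · rintro ⟨hinf, hfin⟩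
    refine ⟨hg.isAcyclicIn hinf, ?_, hg.exists_biInfinitePath hinf hfin⟩
    rintro L ⟨y, hy, rfl⟩
    obtain ⟨z, hz⟩ := hg.exists_apply_sameFoil hinf hfin hy
    refine ⟨_, ⟨z, hy.trans (hz.symm.sameComponent.trans (sameComponent_iterate z 1)), rfl⟩, z, _,
      ?_, hz.symm, (foil_eq hf z).symm⟩
    rw [functionalGraph_eq_mapGraph hf]
    rfl
  · rintro ⟨hinf, hfoils⟩
    refine ⟨hg.isAcyclicIn hinf, Set.eq_empty_of_forall_notMem ?_⟩
    rintro y ⟨hy, hxy⟩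
    exact hg.not_isPrimeval hfoils hxy hy

end Components

/-! ### Integer-valued locally finite measures are sums of atoms. -/

section CountingMeasures

variable {X : Type*} [MeasurableSpace X]

/-- A positive finite value of an integer-valued measure is attained minimally. -/
theorem exists_measurableSet_subset_measure_minimal {μ : Measure X} [SigmaFinite μ]
    (hμ : ∀ B : Set X, MeasurableSet B → ∃ n : ℕ∞, μ B = (n : ℝ≥0∞)) {B : Set X}
    (hB : MeasurableSet B) (hpos : μ B ≠ 0) :
    ∃ A ⊆ B, MeasurableSet A ∧ μ A ≠ 0 ∧
      ∀ U, MeasurableSet U → μ (A ∩ U) = 0 ∨ μ (A \ U) = 0 := by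
  classical
  -- Sigma-finiteness yields a piece of `B` of finite positive mass; the least such integer mass
  -- cannot be split further.
  have hex : ∃ n : ℕ, n ≠ 0 ∧ ∃ A ⊆ B, MeasurableSet A ∧ μ A = n := by
    have hne : ∃ i, μ (B ∩ spanningSets μ i) ≠ 0 := by
      by_contra! h
      apply hpos
      rw [← Set.inter_univ B, ← iUnion_spanningSets μ, Set.inter_iUnion]
      exact measure_iUnion_null h
    obtain ⟨i, hi⟩ := hne
    have hmeas : MeasurableSet (B ∩ spanningSets μ i) := hB.inter (measurableSet_spanningSets μ i)
    obtain ⟨n, hn⟩ := hμ _ hmeas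
    have hlt : μ (B ∩ spanningSets μ i) < ∞ :=
      (measure_mono Set.inter_subset_right).trans_lt (measure_spanningSets_lt_top μ i)
    induction n with
    | top => simp [hn] at hlt
    | coe n =>
      refine ⟨n, ?_, _, Set.inter_subset_left, hmeas, by simpa using hn⟩
      rintro rfl
      exact hi (by simpa using hn)
  obtain ⟨hn0, A, hAB, hA, hAn⟩ := Nat.find_spec hex
  refine ⟨A, hAB, hA, by rw [hAn]; exact_mod_cast hn0, fun U hU => ?_⟩
  by_contra! h
  have hadd := measure_inter_add_sdiff (μ := μ) A hU
  obtain ⟨a, ha⟩ := hμ _ (hA.inter hU)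
  obtain ⟨b, hb⟩ := hμ _ (hA.diff hU)
  rw [ha, hb, hAn] at hadd
  rw [ha, hb] at h
  have hadd' : a + b = (Nat.find hex : ℕ∞) := by exact_mod_cast hadd
  induction a with
  | top => simp at hadd'
  | coe a =>
  induction b with
  | top => simp at hadd'
  | coe b =>
  have hsum : a + b = Nat.find hex := by exact_mod_cast hadd'
  have ha0 : a ≠ 0 := by
    rintro rfl
    exact h.1 (by simp)
  have hb0 : b ≠ 0 := by
    rintro rfl
    exact h.2 (by simp)
  have := Nat.find_min' hex ⟨ha0, A ∩ U, Set.inter_subset_left.trans hAB, hA.inter hU,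
    by simpa using ha⟩
  omega

variable [TopologicalSpace X] [SecondCountableTopology X] [BorelSpace X]

/-- An integer-valued locally finite measure is purely atomic. -/
theorem exists_mem_pointsOf_of_measure_ne_zero [T1Space X] {μ : Measure X}
    [IsLocallyFiniteMeasure μ]
    (hμ : ∀ B : Set X, MeasurableSet B → ∃ n : ℕ∞, μ B = (n : ℝ≥0∞)) {B : Set X}
    (hB : MeasurableSet B) (hpos : μ B ≠ 0) : ∃ x ∈ B, x ∈ pointsOf μ := by
  obtain ⟨A, hAB, hA, hA0, hmin⟩ := exists_measurableSet_subset_measure_minimal hμ hB hpos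
  set b := TopologicalSpace.countableBasis X
  have hb := TopologicalSpace.isBasis_countableBasis X
  -- Each basic open set splits `A` into two parts, one of them null. Off the union `N` of these
  -- countably many null parts, no two points can be separated, so `A \ N` is a single point.
  set N : Set X := (⋃ U ∈ {U ∈ b | μ (A ∩ U) = 0}, A ∩ U) ∪ ⋃ U ∈ {U ∈ b | μ (A \ U) = 0}, A \ U
  have hN : μ N = 0 := by
    have hc := TopologicalSpace.countable_countableBasis X
    exact measure_union_null
      ((measure_biUnion_null_iff (hc.mono fun U hU => hU.1)).2 fun U hU => hU.2)
      ((measure_biUnion_null_iff (hc.mono fun U hU => hU.1)).2 fun U hU => hU.2)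
  have hAN : μ (A \ N) = μ A := measure_sdiff_null hN
  obtain ⟨x, hxA, hxN⟩ : (A \ N).Nonempty := by
    rw [Set.nonempty_iff_ne_empty]
    intro h
    rw [h, measure_empty] at hAN
    exact hA0 hAN.symm
  refine ⟨x, hAB hxA, fun h0 => hA0 ?_⟩
  rw [← hAN]
  refine measure_mono_null ?_ h0
  rintro y ⟨hyA, hyN⟩
  by_contra hxy
  obtain ⟨U, hU, hxU, hUy⟩ := hb.exists_subset_of_mem_open
    (show x ∈ ({y}ᶜ : Set X) from fun h => hxy h.symm) isOpen_compl_singleton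
  rcases hmin U (hb.isOpen hU).measurableSet with h | h
  · exact hxN (Or.inl (Set.mem_biUnion (show U ∈ {U ∈ b | μ (A ∩ U) = 0} from ⟨hU, h⟩) ⟨hxA, hxU⟩))
  · exact hyN (Or.inr (Set.mem_biUnion (show U ∈ {U ∈ b | μ (A \ U) = 0} from ⟨hU, h⟩)
      ⟨hyA, fun hy => hUy hy rfl⟩))

/-- A simple counting measure counts its points. -/
theorem measure_eq_encard_inter_pointsOf [T1Space X] {μ : Measure X} [IsLocallyFiniteMeasure μ]
    (hμ : ∀ B : Set X, MeasurableSet B → ∃ n : ℕ∞, μ B = (n : ℝ≥0∞))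
    (hs : ∀ x : X, μ {x} ≠ 0 → μ {x} = 1) {B : Set X} (hB : MeasurableSet B) :
    μ B = ((B ∩ pointsOf μ).encard : ℝ≥0∞) := by
  have hcount : (pointsOf μ).Countable := by
    refine (Measure.countable_meas_pos_of_disjoint_iUnion (μ := μ) (As := fun x : X => {x})
      (fun x => measurableSet_singleton x) fun x y hxy => Set.disjoint_singleton.2 hxy).mono ?_
    exact fun x hx => pos_iff_ne_zero.2 hx
  have hc : (B ∩ pointsOf μ).Countable := hcount.mono Set.inter_subset_right
  have hnull : μ (B \ pointsOf μ) = 0 := by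
    by_contra h
    obtain ⟨x, hx, hx'⟩ := exists_mem_pointsOf_of_measure_ne_zero hμ
      (hB.diff hcount.measurableSet) h
    exact hx.2 hx'
  rw [← measure_inter_add_sdiff B hcount.measurableSet, hnull, add_zero,
    ← Measure.count_apply hc.measurableSet]
  have hsum : ∀ ν : Measure X, ν (B ∩ pointsOf μ) = ∑' x : ↥(B ∩ pointsOf μ), ν {(x : X)} := by
    intro ν
    conv_lhs => rw [← Set.biUnion_of_singleton (B ∩ pointsOf μ)]
    exact measure_biUnion hc (fun x _ y _ hxy => Set.disjoint_singleton.2 hxy)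
      fun x _ => measurableSet_singleton x
  rw [hsum, hsum]
  refine tsum_congr fun x => ?_
  rw [hs x x.2.2, Measure.count_singleton]

theorem measure_ne_zero_iff_exists_mem_pointsOf [T1Space X] {μ : Measure X}
    [IsLocallyFiniteMeasure μ]
    (hμ : ∀ B : Set X, MeasurableSet B → ∃ n : ℕ∞, μ B = (n : ℝ≥0∞)) {B : Set X}
    (hB : MeasurableSet B) : μ B ≠ 0 ↔ ∃ x ∈ B, x ∈ pointsOf μ :=
  ⟨exists_mem_pointsOf_of_measure_ne_zero hμ hB, fun ⟨_, hx, hx'⟩ h =>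
    hx' (measure_mono_null (Set.singleton_subset_iff.2 hx) h)⟩

end CountingMeasures

/-! ### S-finiteness of locally finite kernels. -/

section Kernels

open ProbabilityTheory

variable {X Ω : Type*} [MeasurableSpace X] [MeasurableSpace Ω]

/-- A kernel of finite measures is s-finite, without a uniform bound on the masses. -/
theorem isSFiniteKernel_of_forall_measure_univ_lt_top (κ : Kernel Ω X)
    (h : ∀ ω, κ ω Set.univ < ∞) : IsSFiniteKernel κ := by
  classical
  have hmeas : ∀ n : ℕ, MeasurableSet {ω | ⌊(κ ω Set.univ).toReal⌋₊ = n} := fun n =>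
    (Nat.measurable_floor.comp
      (κ.measurable_coe MeasurableSet.univ).ennreal_toReal) (measurableSet_singleton n)
  -- Slice `Ω` by the integer part of the total mass: on the `n`-th slice the mass is at most `n +
  -- 1`.
  refine ⟨fun n => Kernel.piecewise (hmeas n) κ 0, fun n => ⟨n + 1, by simp, fun ω => ?_⟩, ?_⟩
  · rw [Kernel.piecewise_apply']
    split_ifs with hω
    · have := (Nat.lt_floor_add_one (κ ω Set.univ).toReal).le
      rw [show ⌊(κ ω Set.univ).toReal⌋₊ = n from hω] at this
      rw [← ENNReal.ofReal_toReal (h ω).ne]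
      refine (ENNReal.ofReal_le_ofReal this).trans_eq ?_
      rw [ENNReal.ofReal_add (by positivity) zero_le_one, ENNReal.ofReal_natCast,
        ENNReal.ofReal_one]
    · simp
  · ext ω s hs
    rw [Kernel.sum_apply' _ _ hs, tsum_eq_single ⌊(κ ω Set.univ).toReal⌋₊]
    · rw [Kernel.piecewise_apply']
      exact (if_pos rfl).symm
    · intro n hn
      rw [Kernel.piecewise_apply']
      exact if_neg fun h => hn h.symm

theorem isSFiniteKernel_of_isLocallyFiniteMeasure [TopologicalSpace X] [SigmaCompactSpace X]
    [LocallyCompactSpace X] [T2Space X] [BorelSpace X] (κ : Kernel Ω X)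
    (h : ∀ ω, IsLocallyFiniteMeasure (κ ω)) :
    IsSFiniteKernel κ := by
  set B : ℕ → Set X := disjointed (CompactExhaustion.choice X)
  have hB : ∀ n, MeasurableSet (B n) :=
    MeasurableSet.disjointed fun n => ((CompactExhaustion.choice X).isCompact n).measurableSet
  have hfin : ∀ n, IsSFiniteKernel (κ.restrict (hB n)) := fun n =>
    isSFiniteKernel_of_forall_measure_univ_lt_top _ fun ω => by
      rw [Kernel.restrict_apply, Measure.restrict_apply_univ]
      exact (measure_mono (disjointed_subset _ n)).trans_lt
        ((CompactExhaustion.choice X).isCompact n).measure_lt_top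
  have hsum : κ = Kernel.sum fun n => κ.restrict (hB n) := by
    ext ω s hs
    rw [Kernel.sum_apply' _ _ hs]
    simp_rw [Kernel.restrict_apply]
    rw [← Measure.sum_apply _ hs, ← Measure.restrict_iUnion (disjoint_disjointed _) hB,
      iUnion_disjointed, (CompactExhaustion.choice X).iUnion_eq, Measure.restrict_univ]
  rw [hsum]
  exact Kernel.isSFiniteKernel_sum

end Kernels

/-! ### Invariance of Haar measure on a unimodular group. -/

section Haar

open Measure

variable {X : Type*} [Group X] [TopologicalSpace X] [IsTopologicalGroup X] [LocallyCompactSpace X]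
  [SecondCountableTopology X] [T2Space X] [MeasurableSpace X] [BorelSpace X]

theorem IsUnimodularGroup.isMulRightInvariant_haar (hX : IsUnimodularGroup X) :
    (haar : Measure X).IsMulRightInvariant := by
  refine ⟨fun g => ?_⟩
  rw [map_right_mul_eq_modularCharacterFun_smul haar g,
    show modularCharacterFun g = 1 from hX g, one_smul]

/-- By right invariance the inverted measure is again left invariant, hence a multiple `c` of Haar
measure; inverting twice gives `c ^ 2 = 1`. -/
theorem IsUnimodularGroup.isInvInvariant_haar (hX : IsUnimodularGroup X) :
    (haar : Measure X).IsInvInvariant := by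
  have := hX.isMulRightInvariant_haar
  set μ : Measure X := haar
  constructor
  let c : ℝ≥0∞ := haarScalarFactor μ.inv μ
  have hc : μ.inv = c • μ := isMulLeftInvariant_eq_smul_of_regular μ.inv μ
  have h2 : map Inv.inv (map Inv.inv μ) = c ^ 2 • μ := by
    rw [← inv_def μ, hc, Measure.map_smul, ← inv_def μ, hc, smul_smul, pow_two]
  have μeq : μ = c ^ 2 • μ := by
    rw [map_map continuous_inv.measurable continuous_inv.measurable] at h2
    simpa only [inv_involutive, Function.Involutive.comp_self, Measure.map_id] using h2
  have K : TopologicalSpace.PositiveCompacts X := Classical.arbitrary _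
  have h3 : c ^ 2 * μ K = 1 ^ 2 * μ K := by
    conv_rhs => rw [μeq]
    simp
  have h4 : c ^ 2 = 1 ^ 2 :=
    (ENNReal.mul_left_inj (measure_pos_of_nonempty_interior _ K.interior_nonempty).ne'
      K.isCompact.measure_lt_top.ne).1 h3
  have h5 : c = 1 := (ENNReal.pow_right_strictMono two_ne_zero).injective h4
  rw [hc, h5, one_smul]

end Haar

/-! ### The mass transport principle. -/

section MassTransport

open Measure ProbabilityTheory

section Pairs

variable {X Ω : Type*} [MeasurableSpace X] [MeasurableSpace Ω] {κ : Kernel Ω X} [IsSFiniteKernel κ]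

theorem measurable_lintegral_out {w : Ω → X → X → ℝ≥0∞}
    (hw : Measurable fun p : Ω × X × X => w p.1 p.2.1 p.2.2) :
    Measurable fun p : Ω × X => ∫⁻ y, w p.1 p.2 y ∂κ p.1 :=
  Measurable.lintegral_kernel_prod_right (κ := κ.comap Prod.fst measurable_fst)
    (f := fun (p : Ω × X) y => w p.1 p.2 y)
    (hw.comp (show Measurable fun q : (Ω × X) × X => (q.1.1, q.1.2, q.2) by fun_prop))

theorem measurable_lintegral_in {w : Ω → X → X → ℝ≥0∞}
    (hw : Measurable fun p : Ω × X × X => w p.1 p.2.1 p.2.2) :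
    Measurable fun p : Ω × X => ∫⁻ x, w p.1 x p.2 ∂κ p.1 :=
  measurable_lintegral_out (w := fun ω y x => w ω x y)
    (hw.comp (show Measurable fun p : Ω × X × X => (p.1, p.2.2, p.2.1) by fun_prop))

variable {P : Measure Ω} [SFinite P]

theorem lintegral_pairs {f : Ω × X × X → ℝ≥0∞} (hf : Measurable f) :
    ∫⁻ p, f p ∂(P ⊗ₘ (κ ×ₖ κ)) = ∫⁻ ω, ∫⁻ x, ∫⁻ y, f (ω, x, y) ∂κ ω ∂κ ω ∂P := by
  rw [lintegral_compProd hf]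
  refine lintegral_congr fun ω => ?_
  exact Kernel.lintegral_prod _ _ _ (hf.comp measurable_prodMk_left)

theorem lintegral_pairs_symm {f : Ω × X × X → ℝ≥0∞} (hf : Measurable f) :
    ∫⁻ p, f p ∂(P ⊗ₘ (κ ×ₖ κ)) = ∫⁻ ω, ∫⁻ y, ∫⁻ x, f (ω, x, y) ∂κ ω ∂κ ω ∂P := by
  rw [lintegral_compProd hf]
  refine lintegral_congr fun ω => ?_
  exact Kernel.lintegral_prod_symm _ _ _ (hf.comp measurable_prodMk_left)

end Pairs

variable {X Ω : Type*} [Group X] [MeasurableSpace X] [MeasurableSpace Ω] [MulAction X Ω]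

section Invariance

variable [MeasurableMul X] {κ : Kernel Ω X}

theorem IsFlowAdapted.map_mul_left (hκ : IsFlowAdapted κ) (x : X) (ω : Ω) :
    κ (x • ω) = (κ ω).map (x * ·) := by
  ext B hB
  rw [hκ x ω B hB, Measure.map_apply (measurable_const_mul x) hB, ← Set.preimage_smul]
  rfl

theorem IsFlowAdapted.lintegral_smul (hκ : IsFlowAdapted κ) (x : X) (ω : Ω) {f : X → ℝ≥0∞}
    (hf : Measurable f) : ∫⁻ y, f y ∂κ (x • ω) = ∫⁻ y, f (x * y) ∂κ ω := by
  rw [hκ.map_mul_left, lintegral_map hf (measurable_const_mul x)]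

end Invariance

variable [MeasurableMul₂ X] [MeasurableSMul₂ X Ω] {P : Measure Ω} [SFinite P]
  [SMulInvariantMeasure X Ω P] {κ : Kernel Ω X} [IsSFiniteKernel κ]

/-- The second moment measure of a flow-adapted kernel is invariant under the diagonal
action. -/
theorem IsFlowAdapted.lintegral_pairs_smul (hκ : IsFlowAdapted κ) (z : X)
    {f : Ω × X × X → ℝ≥0∞} (hf : Measurable f) :
    ∫⁻ p, f (z • p.1, z * p.2.1, z * p.2.2) ∂(P ⊗ₘ (κ ×ₖ κ)) =
      ∫⁻ p, f p ∂(P ⊗ₘ (κ ×ₖ κ)) := by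
  rw [lintegral_pairs hf, lintegral_pairs (f := fun p => f (z • p.1, z * p.2.1, z * p.2.2))
    (hf.comp (by fun_prop))]
  conv_rhs => rw [← (measurePreserving_smul z P).lintegral_comp
    (measurable_lintegral_out (w := fun ω x y => f (ω, x, y)) hf).lintegral_kernel_prod_right']
  refine lintegral_congr fun ω => ?_
  refine Eq.trans ?_ (hκ.lintegral_smul z ω (f := fun x => ∫⁻ y, f (z • ω, x, y) ∂κ (z • ω))
    (by fun_prop)).symm
  refine lintegral_congr fun x => ?_
  rw [hκ.lintegral_smul z ω (by fun_prop)]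

variable [TopologicalSpace X] [IsTopologicalGroup X] [LocallyCompactSpace X]
  [SecondCountableTopology X] [T2Space X] [BorelSpace X]

/-- A transport `w` is invariant if it is unchanged by the diagonal action. -/
def IsInvariantTransport (w : Ω → X → X → ℝ≥0∞) : Prop :=
  ∀ (z : X) (ω : Ω) (x y : X), w (z • ω) (z * x) (z * y) = w ω x y

/-- Two sets are kept so that each Haar factor can be written as an integral over translations of
the indicator of the other endpoint's window; exchanging integrals and translating moves the
restriction from sender to receiver. -/
theorem haar_mul_lintegral_transport (hX : IsUnimodularGroup X) (hκ : IsFlowAdapted κ)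
    {w : Ω → X → X → ℝ≥0∞} (hw : Measurable fun p : Ω × X × X => w p.1 p.2.1 p.2.2)
    (hinv : IsInvariantTransport w) {A B : Set X} (hA : MeasurableSet A) (hB : MeasurableSet B) :
    haar A * ∫⁻ ω, ∫⁻ x in B, ∫⁻ y, w ω x y ∂κ ω ∂κ ω ∂P =
      haar B * ∫⁻ ω, ∫⁻ y in A, ∫⁻ x, w ω x y ∂κ ω ∂κ ω ∂P := by
  have := hX.isMulRightInvariant_haar
  have := hX.isInvInvariant_haar
  set a : X → ℝ≥0∞ := A.indicator 1
  set b : X → ℝ≥0∞ := B.indicator 1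
  have ha : Measurable a := measurable_one.indicator hA
  have hb : Measurable b := measurable_one.indicator hB
  have hia : ∀ y, ∫⁻ z, a (z * y) ∂haar = haar A := fun y => by
    rw [lintegral_mul_right_eq_self a y, lintegral_indicator_one hA]
  have hib : ∀ x, ∫⁻ z, b (z⁻¹ * x) ∂haar = haar B := fun x => by
    rw [lintegral_inv_eq_self (μ := haar) fun z => b (z * x), lintegral_mul_right_eq_self b x,
      lintegral_indicator_one hB]
  have hw' : ∀ ω x, Measurable (w ω x) := fun ω x =>
    hw.comp (measurable_prodMk_left.comp measurable_prodMk_left)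
  have hw'' : ∀ ω y, Measurable fun x => w ω x y := fun ω y =>
    hw.comp (measurable_prodMk_left.comp measurable_prodMk_right)
  have hout : ∫⁻ ω, ∫⁻ x in B, ∫⁻ y, w ω x y ∂κ ω ∂κ ω ∂P =
      ∫⁻ p, b p.2.1 * w p.1 p.2.1 p.2.2 ∂(P ⊗ₘ (κ ×ₖ κ)) := by
    rw [lintegral_pairs (by fun_prop)]
    refine lintegral_congr fun ω => ?_
    rw [← lintegral_indicator hB]
    refine lintegral_congr fun x => ?_
    by_cases hx : x ∈ B <;> simp [b, hx]
  have hin : ∫⁻ ω, ∫⁻ y in A, ∫⁻ x, w ω x y ∂κ ω ∂κ ω ∂P =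
      ∫⁻ p, a p.2.2 * w p.1 p.2.1 p.2.2 ∂(P ⊗ₘ (κ ×ₖ κ)) := by
    rw [lintegral_pairs_symm (by fun_prop)]
    refine lintegral_congr fun ω => ?_
    rw [← lintegral_indicator hA]
    refine lintegral_congr fun x => ?_
    by_cases hx : x ∈ A <;> simp [a, hx]
  rw [hout, hin, ← lintegral_const_mul _ (by fun_prop), ← lintegral_const_mul _ (by fun_prop)]
  calc ∫⁻ p, haar A * (b p.2.1 * w p.1 p.2.1 p.2.2) ∂(P ⊗ₘ (κ ×ₖ κ))
      = ∫⁻ p, ∫⁻ z, a (z * p.2.2) * (b p.2.1 * w p.1 p.2.1 p.2.2) ∂haar ∂(P ⊗ₘ (κ ×ₖ κ)) := by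
        refine lintegral_congr fun p => ?_
        rw [lintegral_mul_const _ (by fun_prop), hia]
    _ = ∫⁻ z, ∫⁻ p, a (z * p.2.2) * (b p.2.1 * w p.1 p.2.1 p.2.2) ∂(P ⊗ₘ (κ ×ₖ κ)) ∂haar :=
        lintegral_lintegral_swap (by fun_prop)
    _ = ∫⁻ z, ∫⁻ p, b (z⁻¹ * p.2.1) * (a p.2.2 * w p.1 p.2.1 p.2.2) ∂(P ⊗ₘ (κ ×ₖ κ)) ∂haar := by
        refine lintegral_congr fun z => ?_
        -- The diagonal shift by `z` moves the translation from the receiver's window `A` to the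
        -- sender's window `B`, leaving `w` unchanged.
        rw [← hκ.lintegral_pairs_smul z
          (f := fun p => b (z⁻¹ * p.2.1) * (a p.2.2 * w p.1 p.2.1 p.2.2)) (by fun_prop)]
        refine lintegral_congr fun p => ?_
        rw [hinv, inv_mul_cancel_left, mul_left_comm]
    _ = ∫⁻ p, ∫⁻ z, b (z⁻¹ * p.2.1) * (a p.2.2 * w p.1 p.2.1 p.2.2) ∂haar ∂(P ⊗ₘ (κ ×ₖ κ)) :=
        lintegral_lintegral_swap (by fun_prop)
    _ = ∫⁻ p, haar B * (a p.2.2 * w p.1 p.2.1 p.2.2) ∂(P ⊗ₘ (κ ×ₖ κ)) := by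
        refine lintegral_congr fun p => ?_
        rw [lintegral_mul_const _ (by fun_prop), hib]

/-- The mass transport principle on a unimodular group. -/
theorem lintegral_transport_out_eq_in (hX : IsUnimodularGroup X) (hκ : IsFlowAdapted κ)
    {w : Ω → X → X → ℝ≥0∞} (hw : Measurable fun p : Ω × X × X => w p.1 p.2.1 p.2.2)
    (hinv : IsInvariantTransport w) {B : Set X} (hB : MeasurableSet B) :
    ∫⁻ ω, ∫⁻ x in B, ∫⁻ y, w ω x y ∂κ ω ∂κ ω ∂P =
      ∫⁻ ω, ∫⁻ y in B, ∫⁻ x, w ω x y ∂κ ω ∂κ ω ∂P := by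
  have K : TopologicalSpace.PositiveCompacts X := Classical.arbitrary _
  have hK0 : haar (K : Set X) ≠ 0 :=
    (measure_pos_of_nonempty_interior _ K.interior_nonempty).ne'
  have hKt : haar (K : Set X) ≠ ∞ := K.isCompact.measure_lt_top.ne
  have hK : MeasurableSet (K : Set X) := K.isCompact.measurableSet
  have h : ∀ A B : Set X, MeasurableSet A → MeasurableSet B → _ :=
    fun A B => haar_mul_lintegral_transport (P := P) hX hκ hw hinv (A := A) (B := B)
  -- Comparing `B` with `K`, whose Haar measure can be cancelled, reduces the claim to `K` itself.
  refine (ENNReal.mul_right_inj hK0 hKt).1 ?_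
  rw [h _ _ hK hB, ← h _ _ hB hK]
  congr 1
  exact ((ENNReal.mul_right_inj hK0 hKt).1 (h _ _ hK hK)).symm

end MassTransport

/-! ### Masses as numbers of points. -/

section SimplePointProcesses

open ProbabilityTheory

variable {X Ω : Type*} [MeasurableSpace X] [MeasurableSpace Ω] {κ : Kernel Ω X}

theorem forall_mem_pointsOf_of_ae {μ : Measure X} {p : X → Prop} (h : ∀ᵐ x ∂μ, p x) :
    ∀ x ∈ pointsOf μ, p x := by
  intro x hx
  by_contra hp
  exact hx (measure_mono_null (Set.singleton_subset_iff.2 hp) (ae_iff.1 h))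

variable [TopologicalSpace X]

theorem IsSimplePointProcess.one_le_measure (hm : IsSimplePointProcess κ) (ω : Ω) {B : Set X}
    {x : X} (hx : x ∈ B) (hxS : x ∈ pointsOf (κ ω)) : 1 ≤ κ ω B := by
  rw [← hm.simple ω x hxS]
  exact measure_mono (Set.singleton_subset_iff.2 hx)

theorem IsSimplePointProcess.measure_singleton_le_one (hm : IsSimplePointProcess κ) (ω : Ω)
    (x : X) : κ ω {x} ≤ 1 := by
  by_cases h : κ ω {x} = 0
  · simp [h]
  · exact (hm.simple ω x h).le

variable [T2Space X] [BorelSpace X]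

theorem lintegral_transport_out_lt_top {P : Measure Ω} (hm : IsSimplePointProcess κ)
    (hI : HasFiniteNonzeroIntensity P κ) {w : Ω → X → X → ℝ≥0∞}
    (hout : ∀ ω x, ∫⁻ y, w ω x y ∂κ ω ≤ 1) {K : Set X} (hK : IsCompact K) :
    ∫⁻ ω, ∫⁻ x in K, ∫⁻ y, w ω x y ∂κ ω ∂κ ω ∂P < ∞ := by
  have := hI.1
  refine lt_of_le_of_lt ?_ (hK.measure_lt_top (μ := intensityMeasure P κ))
  rw [intensityMeasure_apply hm.measurable hK.measurableSet]
  refine lintegral_mono fun ω => ?_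
  calc ∫⁻ x in K, ∫⁻ y, w ω x y ∂κ ω ∂κ ω ≤ ∫⁻ _ in K, 1 ∂κ ω := lintegral_mono fun x => hout ω x
    _ = κ ω K := by rw [lintegral_one, Measure.restrict_apply_univ]

variable [SecondCountableTopology X]

theorem IsSimplePointProcess.measure_eq_encard (hm : IsSimplePointProcess κ) (ω : Ω) {B : Set X}
    (hB : MeasurableSet B) : κ ω B = ((B ∩ pointsOf (κ ω)).encard : ℝ≥0∞) := by
  have := hm.locallyFinite ω
  exact measure_eq_encard_inter_pointsOf (hm.counting ω) (hm.simple ω) hB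

theorem IsSimplePointProcess.measure_ne_zero_iff (hm : IsSimplePointProcess κ) (ω : Ω) {B : Set X}
    (hB : MeasurableSet B) : κ ω B ≠ 0 ↔ ∃ x : pointsOf (κ ω), (x : X) ∈ B := by
  have := hm.locallyFinite ω
  rw [measure_ne_zero_iff_exists_mem_pointsOf (hm.counting ω) hB]
  exact ⟨fun ⟨x, hx, hx'⟩ => ⟨⟨x, hx'⟩, hx⟩, fun ⟨x, hx⟩ => ⟨x, hx, x.2⟩⟩

theorem IsSimplePointProcess.measure_lt_top_iff (hm : IsSimplePointProcess κ) (ω : Ω) {B : Set X}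
    (hB : MeasurableSet B) : κ ω B < ∞ ↔ {x : pointsOf (κ ω) | (x : X) ∈ B}.Finite := by
  have himage : Subtype.val '' {x : pointsOf (κ ω) | (x : X) ∈ B} = B ∩ pointsOf (κ ω) := by
    ext x
    exact ⟨fun ⟨y, hy, h⟩ => h ▸ ⟨hy, y.2⟩, fun h => ⟨⟨x, h.2⟩, h.1, rfl⟩⟩
  rw [hm.measure_eq_encard ω hB, ← Set.finite_image_iff Subtype.val_injective.injOn, himage,
    ← Set.encard_lt_top_iff, ← ENat.toENNReal_top, ENat.toENNReal_lt]

theorem IsSimplePointProcess.eq_of_measure_le_one (hm : IsSimplePointProcess κ) (ω : Ω) {B : Set X}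
    (hB : MeasurableSet B) (h : κ ω B ≤ 1) {x y : X} (hx : x ∈ B) (hy : y ∈ B)
    (hxS : x ∈ pointsOf (κ ω)) (hyS : y ∈ pointsOf (κ ω)) : x = y := by
  rw [hm.measure_eq_encard ω hB, ← ENat.toENNReal_one, ENat.toENNReal_le,
    Set.encard_le_one_iff] at h
  exact h x y ⟨hx, hxS⟩ ⟨hy, hyS⟩

theorem IsSimplePointProcess.ae_of_forall_mem_pointsOf (hm : IsSimplePointProcess κ) (ω : Ω)
    {p : X → Prop} (hp : MeasurableSet {x | p x}) (h : ∀ x ∈ pointsOf (κ ω), p x) :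
    ∀ᵐ x ∂κ ω, p x := by
  rw [ae_iff]
  by_contra hne
  obtain ⟨x, hx⟩ := (hm.measure_ne_zero_iff ω hp.compl).1 hne
  exact hx (h x x.2)

theorem IsSimplePointProcess.finite_setOf_iff (hm : IsSimplePointProcess κ)
    {ω : Ω} {p : X → Prop}
    (hp : MeasurableSet {x | p x}) {q : pointsOf (κ ω) → Prop} (h : ∀ x, q x ↔ p x) :
    {x | q x}.Finite ↔ κ ω {x | p x} < ∞ := by
  rw [hm.measure_lt_top_iff ω hp, show {x | q x} = {x : pointsOf (κ ω) | (x : X) ∈ {x | p x}} from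
    Set.ext h]

/-- Turns the mass statements of `ae_measure_class_lt_top` into the finiteness statements of
`HasMassTransportProperties`. -/
theorem IsSimplePointProcess.finite_class (hm : IsSimplePointProcess κ)
    {ω : Ω} {E : X → X → Prop}
    {D : X → Prop} {E' : pointsOf (κ ω) → pointsOf (κ ω) → Prop} {D' : pointsOf (κ ω) → Prop}
    (hE : ∀ y, MeasurableSet {x | E x y}) (hD : MeasurableSet {x | D x})
    (hEE' : ∀ x y, E' x y ↔ E x y) (hDD' : ∀ x, D' x ↔ D x)
    (h : ∀ y ∈ pointsOf (κ ω), D y → κ ω {z | E z y ∧ D z} < ∞ → κ ω {z | E z y} < ∞)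
    (y : pointsOf (κ ω)) (hy : D' y) (hfin : {z | E' z y ∧ D' z}.Finite) :
    {z | E' z y}.Finite := by
  rw [hm.finite_setOf_iff (hE y) fun z => hEE' z y]
  refine h y y.2 ((hDD' y).1 hy) ?_
  exact (hm.finite_setOf_iff (p := fun z => E z y ∧ D z) ((hE y).inter hD)
    fun z => and_congr (hEE' z y) (hDD' z)).1 hfin

theorem IsSimplePointProcess.isSFiniteKernel [LocallyCompactSpace X]
    (hm : IsSimplePointProcess κ) : IsSFiniteKernel κ :=
  isSFiniteKernel_of_isLocallyFiniteMeasure κ hm.locallyFinite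

end SimplePointProcesses

/-! ### Transports with bounded outgoing mass. -/

section PointProcessTransport

open Measure ProbabilityTheory

variable {X Ω : Type*} [Group X] [MeasurableSpace X] [MeasurableSpace Ω] [MulAction X Ω]
  [TopologicalSpace X] [IsTopologicalGroup X] [LocallyCompactSpace X]
  [SecondCountableTopology X] [T2Space X] [BorelSpace X] {κ : Kernel Ω X}

variable [MeasurableSMul₂ X Ω] {P : Measure Ω} [IsProbabilityMeasure P]
  [SMulInvariantMeasure X Ω P]

/-- If every point sends out mass at most one, then every point receives finite mass. -/
theorem ae_forall_lintegral_in_lt_top (hX : IsUnimodularGroup X) (hm : IsSimplePointProcess κ)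
    (hκ : IsFlowAdapted κ) (hI : HasFiniteNonzeroIntensity P κ) {w : Ω → X → X → ℝ≥0∞}
    (hw : Measurable fun p : Ω × X × X => w p.1 p.2.1 p.2.2) (hinv : IsInvariantTransport w)
    (hout : ∀ ω x, ∫⁻ y, w ω x y ∂κ ω ≤ 1) :
    ∀ᵐ ω ∂P, ∀ y ∈ pointsOf (κ ω), ∫⁻ x, w ω x y ∂κ ω < ∞ := by
  have := hm.isSFiniteKernel
  set K := CompactExhaustion.choice X
  have hfin : ∀ᵐ ω ∂P, ∀ n, ∫⁻ y in K n, ∫⁻ x, w ω x y ∂κ ω ∂κ ω < ∞ := by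
    rw [ae_all_iff]
    intro n
    have hKn := (K.isCompact n).measurableSet
    refine ae_lt_top ?_ ?_
    · exact Measurable.lintegral_kernel_prod_right' (κ := κ.restrict hKn)
        (measurable_lintegral_in hw)
    · rw [← lintegral_transport_out_eq_in hX hκ hw hinv hKn]
      exact (lintegral_transport_out_lt_top hm hI hout (K.isCompact n)).ne
  filter_upwards [hfin] with ω hω y hy
  obtain ⟨n, hn⟩ := K.exists_mem y
  -- The point `y` is an atom of mass one in `K n`, so what it receives is at most the integral over
  -- `K n`.
  have h := (lintegral_mono_set (μ := κ ω) (f := fun y => ∫⁻ x, w ω x y ∂κ ω)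
    (Set.singleton_subset_iff.2 hn)).trans_lt (hω n)
  rwa [lintegral_singleton, hm.simple ω y hy, mul_one] at h

/-- If every point sends out mass at most one, and receives at least what it sends out, then it
receives exactly what it sends out. -/
theorem ae_forall_lintegral_in_eq_out (hX : IsUnimodularGroup X) (hm : IsSimplePointProcess κ)
    (hκ : IsFlowAdapted κ) (hI : HasFiniteNonzeroIntensity P κ) {w : Ω → X → X → ℝ≥0∞}
    (hw : Measurable fun p : Ω × X × X => w p.1 p.2.1 p.2.2) (hinv : IsInvariantTransport w)
    (hout : ∀ ω x, ∫⁻ y, w ω x y ∂κ ω ≤ 1)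
    (hle : ∀ᵐ ω ∂P, ∀ y ∈ pointsOf (κ ω), ∫⁻ x, w ω y x ∂κ ω ≤ ∫⁻ x, w ω x y ∂κ ω) :
    ∀ᵐ ω ∂P, ∀ y ∈ pointsOf (κ ω), ∫⁻ x, w ω y x ∂κ ω = ∫⁻ x, w ω x y ∂κ ω := by
  have := hm.isSFiniteKernel
  have mout := measurable_lintegral_out (κ := κ) hw
  have min := measurable_lintegral_in (κ := κ) hw
  set K := CompactExhaustion.choice X
  have hle' : ∀ᵐ p ∂(P ⊗ₘ κ), ∫⁻ x, w p.1 p.2 x ∂κ p.1 ≤ ∫⁻ x, w p.1 x p.2 ∂κ p.1 := by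
    refine Measure.ae_compProd_of_ae_ae (measurableSet_le mout min) ?_
    filter_upwards [hle] with ω hω
    exact hm.ae_of_forall_mem_pointsOf ω
      ((measurableSet_le mout min).preimage measurable_prodMk_left) hω
  have heq : ∀ᵐ p ∂(P ⊗ₘ κ), ∀ n, p.2 ∈ K n →
      ∫⁻ x, w p.1 p.2 x ∂κ p.1 = ∫⁻ x, w p.1 x p.2 ∂κ p.1 := by
    rw [ae_all_iff]
    intro n
    have hKn := (K.isCompact n).measurableSet
    have hset : ∀ f : Ω × X → ℝ≥0∞, Measurable f →
        ∫⁻ p in Set.univ ×ˢ K n, f p ∂(P ⊗ₘ κ) = ∫⁻ ω, ∫⁻ x in K n, f (ω, x) ∂κ ω ∂P := by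
      intro f hf
      rw [Measure.setLIntegral_compProd hf MeasurableSet.univ hKn, Measure.restrict_univ]
    -- Over `K n`, outgoing mass is dominated by incoming mass and both have the same finite
    -- expectation, so they agree almost everywhere.
    have h := ae_eq_of_ae_le_of_lintegral_le (ae_restrict_of_ae (s := Set.univ ×ˢ K n) hle')
      (by
        rw [hset _ mout]
        exact (lintegral_transport_out_lt_top hm hI hout (K.isCompact n)).ne)
      min.aemeasurable
      (by rw [hset _ mout, hset _ min, lintegral_transport_out_eq_in hX hκ hw hinv hKn])
    filter_upwards [(ae_restrict_iff' (MeasurableSet.univ.prod hKn)).1 h] with p hp hpn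
    exact hp ⟨trivial, hpn⟩
  filter_upwards [Measure.ae_ae_of_ae_compProd heq] with ω hω y hy
  obtain ⟨n, hn⟩ := K.exists_mem y
  exact forall_mem_pointsOf_of_ae hω y hy n hn

end PointProcessTransport

/-! ### Measurable invariant properties, relations and maps. -/

section Covariance

open ProbabilityTheory

variable {X Ω : Type*} [Group X] [MeasurableSpace X] [MeasurableSpace Ω] [MulAction X Ω]

/-- A measurable property of points that is invariant under the diagonal action. -/
structure IsInvariantProperty (D : Ω → X → Prop) : Prop where
  measurableSet : MeasurableSet {p : Ω × X | D p.1 p.2}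
  smul_iff : ∀ (z : X) (ω : Ω) (x : X), D (z • ω) (z * x) ↔ D ω x

/-- A measurable relation between points that is invariant under the diagonal action. -/
structure IsInvariantRelation (E : Ω → X → X → Prop) : Prop where
  measurableSet : MeasurableSet {p : Ω × X × X | E p.1 p.2.1 p.2.2}
  smul_iff : ∀ (z : X) (ω : Ω) (x y : X), E (z • ω) (z * x) (z * y) ↔ E ω x y

/-- A measurable map of points that commutes with the diagonal action. -/
structure IsEquivariantMap (F : Ω → X → X) : Prop where
  measurable : Measurable fun p : Ω × X => F p.1 p.2
  smul_apply : ∀ (z : X) (ω : Ω) (x : X), F (z • ω) (z * x) = z * F ω x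

namespace IsInvariantProperty

variable {D D' : Ω → X → Prop}

theorem and (h : IsInvariantProperty D) (h' : IsInvariantProperty D') :
    IsInvariantProperty fun ω x => D ω x ∧ D' ω x :=
  ⟨h.measurableSet.inter h'.measurableSet, fun z ω x =>
    and_congr (h.smul_iff z ω x) (h'.smul_iff z ω x)⟩

theorem not (h : IsInvariantProperty D) : IsInvariantProperty fun ω x => ¬ D ω x :=
  ⟨h.measurableSet.compl, fun z ω x => not_congr (h.smul_iff z ω x)⟩

theorem forall_nat {D : ℕ → Ω → X → Prop} (h : ∀ n, IsInvariantProperty (D n)) :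
    IsInvariantProperty fun ω x => ∀ n, D n ω x := by
  refine ⟨?_, fun z ω x => forall_congr' fun n => (h n).smul_iff z ω x⟩
  convert MeasurableSet.iInter fun n => (h n).measurableSet using 1
  ext p
  simp

theorem exists_nat {D : ℕ → Ω → X → Prop} (h : ∀ n, IsInvariantProperty (D n)) :
    IsInvariantProperty fun ω x => ∃ n, D n ω x := by
  refine ⟨?_, fun z ω x => exists_congr fun n => (h n).smul_iff z ω x⟩
  convert MeasurableSet.iUnion fun n => (h n).measurableSet using 1
  ext p
  simp

theorem comp (h : IsInvariantProperty D) {F : Ω → X → X} (hF : IsEquivariantMap F) :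
    IsInvariantProperty fun ω x => D ω (F ω x) :=
  ⟨h.measurableSet.preimage (measurable_fst.prodMk hF.measurable), fun z ω x => by
    rw [hF.smul_apply, h.smul_iff]⟩

theorem measurableSet_section (h : IsInvariantProperty D) (ω : Ω) : MeasurableSet {x | D ω x} :=
  h.measurableSet.preimage measurable_prodMk_left

end IsInvariantProperty

namespace IsEquivariantMap

variable {F G : Ω → X → X}

theorem id : IsEquivariantMap fun (_ : Ω) (x : X) => x := ⟨measurable_snd, fun _ _ _ => rfl⟩

theorem comp (hF : IsEquivariantMap F) (hG : IsEquivariantMap G) :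
    IsEquivariantMap fun ω x => F ω (G ω x) :=
  ⟨hF.measurable.comp (measurable_fst.prodMk hG.measurable), fun z ω x => by
    rw [hG.smul_apply, hF.smul_apply]⟩

theorem iterate (hF : IsEquivariantMap F) (n : ℕ) : IsEquivariantMap fun ω => (F ω)^[n] := by
  induction n with
  | zero => exact id
  | succ n ih =>
    simp only [Function.iterate_succ']
    exact hF.comp ih

end IsEquivariantMap

namespace IsInvariantRelation

variable {E E' : Ω → X → X → Prop}

theorem and (h : IsInvariantRelation E) (h' : IsInvariantRelation E') :
    IsInvariantRelation fun ω x y => E ω x y ∧ E' ω x y :=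
  ⟨h.measurableSet.inter h'.measurableSet, fun z ω x y =>
    and_congr (h.smul_iff z ω x y) (h'.smul_iff z ω x y)⟩

theorem exists_nat {E : ℕ → Ω → X → X → Prop} (h : ∀ n, IsInvariantRelation (E n)) :
    IsInvariantRelation fun ω x y => ∃ n, E n ω x y := by
  refine ⟨?_, fun z ω x y => exists_congr fun n => (h n).smul_iff z ω x y⟩
  convert MeasurableSet.iUnion fun n => (h n).measurableSet using 1
  ext p
  simp

theorem swap (h : IsInvariantRelation E) : IsInvariantRelation fun ω x y => E ω y x :=
  ⟨h.measurableSet.preimage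
    (show Measurable fun p : Ω × X × X => (p.1, p.2.2, p.2.1) by fun_prop),
    fun z ω x y => h.smul_iff z ω y x⟩

theorem comp (h : IsInvariantRelation E) {F G : Ω → X → X} (hF : IsEquivariantMap F)
    (hG : IsEquivariantMap G) : IsInvariantRelation fun ω x y => E ω (F ω x) (G ω y) := by
  refine ⟨h.measurableSet.preimage (measurable_fst.prodMk
    ((hF.measurable.comp (show Measurable fun p : Ω × X × X => (p.1, p.2.1) by fun_prop)).prodMk
    (hG.measurable.comp (show Measurable fun p : Ω × X × X => (p.1, p.2.2) by fun_prop)))),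
    fun z ω x y => ?_⟩
  rw [hF.smul_apply, hG.smul_apply, h.smul_iff]

theorem of_left {D : Ω → X → Prop} (h : IsInvariantProperty D) :
    IsInvariantRelation fun ω x (_ : X) => D ω x :=
  ⟨h.measurableSet.preimage (show Measurable fun p : Ω × X × X => (p.1, p.2.1) by fun_prop),
    fun z ω x _ => h.smul_iff z ω x⟩

theorem of_right {D : Ω → X → Prop} (h : IsInvariantProperty D) :
    IsInvariantRelation fun ω (_ : X) y => D ω y :=
  (of_left h).swap

theorem diagonal (h : IsInvariantRelation E) : IsInvariantProperty fun ω x => E ω x x :=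
  ⟨h.measurableSet.preimage (show Measurable fun p : Ω × X => (p.1, p.2, p.2) by fun_prop),
    fun z ω x => h.smul_iff z ω x x⟩

theorem eq [TopologicalSpace X] [SecondCountableTopology X] [T2Space X] [BorelSpace X] :
    IsInvariantRelation fun (_ : Ω) (x y : X) => x = y :=
  ⟨(isClosed_diagonal.measurableSet : MeasurableSet (Set.diagonal X)).preimage measurable_snd,
    fun z _ _ _ => mul_right_inj z⟩

theorem measurableSet_section (h : IsInvariantRelation E) (ω : Ω) (y : X) :
    MeasurableSet {x | E ω x y} :=
  h.measurableSet.preimage (measurable_const.prodMk (measurable_id.prodMk measurable_const))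

variable {κ : Kernel Ω X}

theorem measurable_measure [IsSFiniteKernel κ] (h : IsInvariantRelation E) :
    Measurable fun p : Ω × X => κ p.1 {x | E p.1 x p.2} :=
  Kernel.measurable_kernel_prodMk_left (κ := κ.comap Prod.fst measurable_fst)
    (t := {q : (Ω × X) × X | E q.1.1 q.2 q.1.2})
    (h.measurableSet.preimage
      (show Measurable fun q : (Ω × X) × X => (q.1.1, q.2, q.1.2) by fun_prop))

theorem measure_smul [MeasurableMul X] (h : IsInvariantRelation E) (hκ : IsFlowAdapted κ) (z : X)
    (ω : Ω) (y : X) : κ (z • ω) {x | E (z • ω) x (z * y)} = κ ω {x | E ω x y} := by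
  rw [hκ.map_mul_left, Measure.map_apply (measurable_const_mul z) (h.measurableSet_section _ _)]
  congr 1
  ext x
  exact h.smul_iff z ω x y

theorem measure_lt_top [MeasurableMul X] [IsSFiniteKernel κ]
    (h : IsInvariantRelation E) (hκ : IsFlowAdapted κ) :
    IsInvariantProperty fun ω y => κ ω {x | E ω x y} < ∞ :=
  ⟨measurableSet_lt h.measurable_measure measurable_const, fun z ω y => by
    rw [h.measure_smul hκ]⟩

theorem measure_ne_zero [MeasurableMul X] [IsSFiniteKernel κ]
    (h : IsInvariantRelation E) (hκ : IsFlowAdapted κ) :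
    IsInvariantProperty fun ω y => κ ω {x | E ω x y} ≠ 0 :=
  ⟨(h.measurable_measure (measurableSet_singleton 0)).compl, fun z ω y => by
    rw [h.measure_smul hκ]⟩

end IsInvariantRelation

end Covariance

/-! ### Consequences of mass transport for invariant relations. -/

section Selection

open ProbabilityTheory

variable {X Ω : Type*} [Group X] [MeasurableSpace X] [MeasurableSpace Ω] [MulAction X Ω]

theorem IsInvariantRelation.isInvariantTransport_indicator {E : Ω → X → X → Prop}
    (hE : IsInvariantRelation E) {c : Ω → X → ℝ≥0∞}
    (hc : ∀ (z : X) (ω : Ω) (y : X), c (z • ω) (z * y) = c ω y) :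
    IsInvariantTransport fun ω x y => {p : Ω × X × X | E p.1 p.2.1 p.2.2}.indicator
      (fun p => c p.1 p.2.2) (ω, x, y) := by
  intro z ω x y
  have h := hE.smul_iff z ω x y
  by_cases hxy : E ω x y
  · simp [hxy, h.2 hxy, hc]
  · simp [hxy, mt h.1 hxy]

theorem IsInvariantRelation.lintegral_indicator_left {κ : Kernel Ω X} {E : Ω → X → X → Prop}
    (hE : IsInvariantRelation E) (ω : Ω) (y : X) :
    ∫⁻ x, {p : Ω × X × X | E p.1 p.2.1 p.2.2}.indicator (fun _ => 1) (ω, x, y) ∂κ ω =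
      κ ω {x | E ω x y} :=
  lintegral_indicator_one (hE.measurableSet_section ω y)

theorem IsInvariantRelation.lintegral_indicator_right {κ : Kernel Ω X} {E : Ω → X → X → Prop}
    (hE : IsInvariantRelation E) (ω : Ω) (x : X) :
    ∫⁻ y, {p : Ω × X × X | E p.1 p.2.1 p.2.2}.indicator (fun _ => 1) (ω, x, y) ∂κ ω =
      κ ω {y | E ω x y} :=
  lintegral_indicator_one (hE.swap.measurableSet_section ω x)

variable [TopologicalSpace X] [IsTopologicalGroup X] [LocallyCompactSpace X]
  [SecondCountableTopology X] [T2Space X] [BorelSpace X] {κ : Kernel Ω X}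
  [MeasurableSMul₂ X Ω] {P : Measure Ω} [IsProbabilityMeasure P]
  [SMulInvariantMeasure X Ω P]

/-- No infinite class of an invariant equivalence relation on the points of a point process of
finite intensity has a distinguished nonempty finite subset. -/
theorem ae_measure_class_lt_top (hX : IsUnimodularGroup X) (hm : IsSimplePointProcess κ)
    (hκ : IsFlowAdapted κ) (hI : HasFiniteNonzeroIntensity P κ) {E : Ω → X → X → Prop}
    (hE : IsInvariantRelation E) (hsymm : ∀ ω x y, E ω x y → E ω y x)
    (htrans : ∀ ω x y z, E ω x y → E ω y z → E ω x z) {D : Ω → X → Prop}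
    (hD : IsInvariantProperty D) :
    ∀ᵐ ω ∂P, ∀ y ∈ pointsOf (κ ω), D ω y → κ ω {z | E ω z y ∧ D ω z} < ∞ →
      κ ω {z | E ω z y} < ∞ := by
  have := hm.isSFiniteKernel
  have hED : IsInvariantRelation fun ω z y => E ω z y ∧ D ω z :=
    hE.and (IsInvariantRelation.of_left hD)
  have hR : IsInvariantRelation fun ω x y => E ω x y ∧ D ω y :=
    hE.and (IsInvariantRelation.of_right hD)
  set N : Ω → X → ℝ≥0∞ := fun ω y => κ ω {z | E ω z y ∧ D ω z}
  have hN : Measurable fun p : Ω × X => N p.1 p.2 := hED.measurable_measure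
  -- Each point spreads its mass evenly over the distinguished points of its class, sending `1 / N`
  -- to each.
  set w : Ω → X → X → ℝ≥0∞ := fun ω x y =>
    {p : Ω × X × X | E p.1 p.2.1 p.2.2 ∧ D p.1 p.2.2}.indicator (fun p => (N p.1 p.2.2)⁻¹) (ω, x, y)
  have hw : Measurable fun p : Ω × X × X => w p.1 p.2.1 p.2.2 :=
    (hN.inv.comp (show Measurable fun p : Ω × X × X => (p.1, p.2.2) by fun_prop)).indicator
      hR.measurableSet
  have hinv : IsInvariantTransport w :=
    hR.isInvariantTransport_indicator (c := fun ω y => (N ω y)⁻¹) fun z ω y =>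
      congrArg _ (hED.measure_smul hκ z ω y)
  have hout : ∀ ω x, ∫⁻ y, w ω x y ∂κ ω ≤ 1 := by
    intro ω x
    have hset : {y | E ω x y ∧ D ω y} = {z | E ω z x ∧ D ω z} :=
      Set.ext fun y => and_congr_left' ⟨hsymm ω x y, hsymm ω y x⟩
    have hmeas : MeasurableSet {y | E ω x y ∧ D ω y} := by
      rw [hset]
      exact hED.measurableSet_section ω x
    calc ∫⁻ y, w ω x y ∂κ ω
        = ∫⁻ y, {y | E ω x y ∧ D ω y}.indicator (fun _ => (N ω x)⁻¹) y ∂κ ω := by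
          refine lintegral_congr fun y => ?_
          by_cases h : E ω x y ∧ D ω y
          · have hNxy : N ω y = N ω x := congrArg (κ ω) (Set.ext fun z => and_congr_left'
              ⟨fun hz => htrans ω z y x hz (hsymm ω x y h.1), fun hz => htrans ω z x y hz h.1⟩)
            simp only [w, Set.indicator, Set.mem_ofPred_eq, h, and_self, if_true, hNxy]
          · simp only [w, Set.indicator, Set.mem_ofPred_eq, h, if_false]
      _ = (N ω x)⁻¹ * N ω x := by rw [lintegral_indicator_const hmeas, hset]
      -- This also covers `N = 0` and `N = ∞`, where the product is `0`.
      _ ≤ 1 := ENNReal.inv_mul_le_one _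
  filter_upwards [ae_forall_lintegral_in_lt_top hX hm hκ hI hw hinv hout] with ω hω y hy hDy hfin
  have hin : ∫⁻ x, w ω x y ∂κ ω = (N ω y)⁻¹ * κ ω {z | E ω z y} := by
    rw [← lintegral_indicator_const (hE.measurableSet_section ω y)]
    refine lintegral_congr fun x => ?_
    by_cases h : E ω x y <;> simp [w, h, hDy, N]
  have h := hω y hy
  rw [hin] at h
  -- A distinguished point receives `1 / N` from every member of its class, an infinite amount if
  -- the class is infinite.
  by_contra htop
  rw [not_lt, top_le_iff] at htop
  rw [htop, ENNReal.mul_top (ENNReal.inv_ne_zero.2 hfin.ne)] at h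
  exact lt_irrefl _ h

/-- In an invariant relation with out-degrees at most one, in-degrees are finite. -/
theorem IsInvariantRelation.ae_measure_in_lt_top (hX : IsUnimodularGroup X)
    (hm : IsSimplePointProcess κ) (hκ : IsFlowAdapted κ) (hI : HasFiniteNonzeroIntensity P κ)
    {E : Ω → X → X → Prop} (hE : IsInvariantRelation E) (hout : ∀ ω x, κ ω {y | E ω x y} ≤ 1) :
    ∀ᵐ ω ∂P, ∀ y ∈ pointsOf (κ ω), κ ω {x | E ω x y} < ∞ := by
  simp_rw [← hE.lintegral_indicator_left]
  refine ae_forall_lintegral_in_lt_top hX hm hκ hI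
    (measurable_const.indicator hE.measurableSet)
    (hE.isInvariantTransport_indicator (c := fun _ _ => 1) fun _ _ _ => rfl) fun ω x => ?_
  rw [hE.lintegral_indicator_right]
  exact hout ω x

/-- In an invariant relation with out-degrees at most one, where no in-degree is less than the
out-degree, in-degrees are at most one. -/
theorem IsInvariantRelation.ae_measure_in_le_one (hX : IsUnimodularGroup X)
    (hm : IsSimplePointProcess κ) (hκ : IsFlowAdapted κ) (hI : HasFiniteNonzeroIntensity P κ)
    {E : Ω → X → X → Prop} (hE : IsInvariantRelation E) (hout : ∀ ω x, κ ω {y | E ω x y} ≤ 1)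
    (hle : ∀ᵐ ω ∂P, ∀ y ∈ pointsOf (κ ω), κ ω {x | E ω y x} ≤ κ ω {x | E ω x y}) :
    ∀ᵐ ω ∂P, ∀ y ∈ pointsOf (κ ω), κ ω {x | E ω x y} ≤ 1 := by
  have h := ae_forall_lintegral_in_eq_out (P := P) hX hm hκ hI
    (measurable_const.indicator hE.measurableSet)
    (hE.isInvariantTransport_indicator (c := fun _ _ => 1) fun _ _ _ => rfl)
    (fun ω x => by rw [hE.lintegral_indicator_right]; exact hout ω x)
    (by
      filter_upwards [hle] with ω hω y hy
      rw [hE.lintegral_indicator_right, hE.lintegral_indicator_left]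
      exact hω y hy)
  filter_upwards [h] with ω hω y hy
  rw [← hE.lintegral_indicator_left, ← hω y hy, hE.lintegral_indicator_right]
  exact hout ω y

end Selection

/-! ### Application to the point-shift. -/

section PointShifts

open ProbabilityTheory

variable {X Ω : Type*} [Group X] [MeasurableSpace X] [MeasurableSpace Ω] [MulAction X Ω]
  {κ : Kernel Ω X} {H : Ω → X → X}

theorem IsFlowAdaptedPointShift.isEquivariantMap {P : Measure Ω} {m : Ω → Measure X}
    (hH : IsFlowAdaptedPointShift P m H) : IsEquivariantMap H :=
  ⟨hH.measurable, fun z ω x => hH.flowAdapted ω x z⟩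

namespace IsEquivariantMap

variable [TopologicalSpace X] [SecondCountableTopology X] [T2Space X] [BorelSpace X]

/-- A countable union of preimages of the closed diagonal under pairs of iterates. -/
theorem isInvariantRelation_sameComponent (hH : IsEquivariantMap H) :
    IsInvariantRelation fun ω x y => SameComponent (H ω) x y :=
  .exists_nat fun n => .exists_nat fun k => IsInvariantRelation.eq.comp (hH.iterate n) (hH.iterate k)

theorem isInvariantRelation_sameFoil (hH : IsEquivariantMap H) :
    IsInvariantRelation fun ω x y => SameFoil (H ω) x y :=
  .exists_nat fun n => IsInvariantRelation.eq.comp (hH.iterate n) (hH.iterate n)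

theorem isInvariantRelation_iterate_eq (hH : IsEquivariantMap H) (n : ℕ) :
    IsInvariantRelation fun ω x y => (H ω)^[n] x = y :=
  IsInvariantRelation.eq.comp (hH.iterate n) .id

theorem isInvariantProperty_periodic (hH : IsEquivariantMap H) :
    IsInvariantProperty fun ω x => ∃ n, (H ω)^[n + 1] x = x :=
  .exists_nat fun n => (hH.isInvariantRelation_iterate_eq (n + 1)).diagonal

variable [MeasurableMul X] [IsSFiniteKernel κ]

theorem isInvariantProperty_finite_foil (hH : IsEquivariantMap H) (hκ : IsFlowAdapted κ) :
    IsInvariantProperty fun ω x => κ ω {z | SameFoil (H ω) z x} < ∞ :=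
  hH.isInvariantRelation_sameFoil.measure_lt_top hκ

theorem isInvariantProperty_lastFinite (hH : IsEquivariantMap H) (hκ : IsFlowAdapted κ) :
    IsInvariantProperty fun ω x => κ ω {z | SameFoil (H ω) z x} < ∞ ∧
      ¬ κ ω {z | SameFoil (H ω) z (H ω x)} < ∞ :=
  (hH.isInvariantProperty_finite_foil hκ).and ((hH.isInvariantProperty_finite_foil hκ).comp hH).not

theorem isInvariantProperty_youngestFinite (hH : IsEquivariantMap H) (hκ : IsFlowAdapted κ) :
    IsInvariantProperty fun ω x => κ ω {z | SameFoil (H ω) z x} < ∞ ∧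
      ¬ κ ω {z | SameFoil (H ω) (H ω z) x} ≠ 0 :=
  (hH.isInvariantProperty_finite_foil hκ).and
    ((hH.isInvariantRelation_sameFoil.comp hH .id).measure_ne_zero hκ).not

/-- Being an image point is phrased as positive mass of a fibre, so that measurability follows from
that of the kernel rather than from a projection. -/
theorem isInvariantProperty_primeval (hH : IsEquivariantMap H) (hκ : IsFlowAdapted κ) :
    IsInvariantProperty fun ω y => ∀ n, κ ω {x | (H ω)^[n] x = y} ≠ 0 :=
  .forall_nat fun n => (hH.isInvariantRelation_iterate_eq n).measure_ne_zero hκ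

end IsEquivariantMap

section Restriction

variable [TopologicalSpace X] [SecondCountableTopology X] [T2Space X] [BorelSpace X] {ω : Ω}

variable (hf : Set.MapsTo (H ω) (pointsOf (κ ω)) (pointsOf (κ ω)))

theorem IsSimplePointProcess.finite_foil_iff (hm : IsSimplePointProcess κ)
    (hH : IsEquivariantMap H) (y : pointsOf (κ ω)) :
    {z | SameFoil (hf.restrict _ _ _) z y}.Finite ↔ κ ω {z | SameFoil (H ω) z y} < ∞ :=
  hm.finite_setOf_iff (hH.isInvariantRelation_sameFoil.measurableSet_section ω y) fun z =>
    sameFoil_restrict_iff hf z y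

theorem IsSimplePointProcess.inLastFiniteFoil_iff (hm : IsSimplePointProcess κ)
    (hH : IsEquivariantMap H) (y : pointsOf (κ ω)) :
    InLastFiniteFoil (hf.restrict _ _ _) y ↔ κ ω {z | SameFoil (H ω) z y} < ∞ ∧
      ¬ κ ω {z | SameFoil (H ω) z (H ω y)} < ∞ :=
  and_congr (hm.finite_foil_iff hf hH y) (not_congr (hm.finite_foil_iff hf hH _))

theorem IsSimplePointProcess.inYoungestFiniteFoil_iff (hm : IsSimplePointProcess κ)
    (hH : IsEquivariantMap H) (y : pointsOf (κ ω)) :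
    InYoungestFiniteFoil (hf.restrict _ _ _) y ↔ κ ω {z | SameFoil (H ω) z y} < ∞ ∧
      ¬ κ ω {z | SameFoil (H ω) (H ω z) y} ≠ 0 := by
  refine and_congr (hm.finite_foil_iff hf hH y) (not_congr ?_)
  rw [hm.measure_ne_zero_iff ω
    ((hH.isInvariantRelation_sameFoil.comp hH .id).measurableSet_section ω y)]
  exact exists_congr fun z => sameFoil_restrict_iff hf _ _

theorem IsSimplePointProcess.isPrimeval_iff (hm : IsSimplePointProcess κ)
    (hH : IsEquivariantMap H) (y : pointsOf (κ ω)) :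
    IsPrimeval (hf.restrict _ _ _) y ↔ ∀ n, κ ω {x | (H ω)^[n] x = y} ≠ 0 := by
  refine forall_congr' fun n => ?_
  rw [hm.measure_ne_zero_iff ω ((hH.isInvariantRelation_iterate_eq n).measurableSet_section ω y)]
  exact exists_congr fun z => coe_iterate_eq_iff hf (k := 0)

theorem IsSimplePointProcess.finite_preimage (hm : IsSimplePointProcess κ)
    (hH : IsEquivariantMap H)
    (h : ∀ y ∈ pointsOf (κ ω), κ ω {x | H ω x = y} < ∞) (y : pointsOf (κ ω)) :
    {x | hf.restrict _ _ _ x = y}.Finite :=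
  (hm.finite_setOf_iff (p := fun x => H ω x = y)
    ((hH.isInvariantRelation_iterate_eq 1).measurableSet_section ω y) fun z =>
      coe_iterate_eq_iff hf (n := 1) (k := 0) (x := z) (y := y)).2 (h y y.2)

end Restriction

section AlmostSure

variable [TopologicalSpace X] [IsTopologicalGroup X] [LocallyCompactSpace X]
  [SecondCountableTopology X] [T2Space X] [BorelSpace X] [MeasurableSMul₂ X Ω]
  {P : Measure Ω} [IsProbabilityMeasure P] [SMulInvariantMeasure X Ω P]

theorem ae_measure_preimage_lt_top (hX : IsUnimodularGroup X) (hm : IsSimplePointProcess κ)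
    (hκ : IsFlowAdapted κ) (hI : HasFiniteNonzeroIntensity P κ) (hH : IsEquivariantMap H) :
    ∀ᵐ ω ∂P, ∀ y ∈ pointsOf (κ ω), κ ω {x | H ω x = y} < ∞ := by
  -- Every point sends unit mass to its image; a location carries mass at most one.
  refine (hH.isInvariantRelation_iterate_eq 1).ae_measure_in_lt_top hX hm hκ hI fun ω x => ?_
  refine le_of_eq_of_le ?_ (hm.measure_singleton_le_one ω (H ω x))
  exact congrArg _ (Set.ext fun y => eq_comm)

/-- Only primeval points send mass, to their images. Each receives at least one unit, from a
primeval preimage, and therefore exactly one. -/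
theorem ae_measure_primeval_preimage_le_one (hX : IsUnimodularGroup X)
    (hm : IsSimplePointProcess κ) (hκ : IsFlowAdapted κ) (hI : HasFiniteNonzeroIntensity P κ)
    (hH : IsEquivariantMap H)
    (hmaps : ∀ᵐ ω ∂P, Set.MapsTo (H ω) (pointsOf (κ ω)) (pointsOf (κ ω))) :
    ∀ᵐ ω ∂P, ∀ y ∈ pointsOf (κ ω),
      κ ω {x | (∀ n, κ ω {z | (H ω)^[n] z = x} ≠ 0) ∧ H ω x = y} ≤ 1 := by
  have := hm.isSFiniteKernel
  have hprim := hH.isInvariantProperty_primeval hκ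
  have hR := (IsInvariantRelation.of_left hprim).and (hH.isInvariantRelation_iterate_eq 1)
  have hout : ∀ ω x, κ ω {y | (∀ n, κ ω {z | (H ω)^[n] z = x} ≠ 0) ∧ H ω x = y} ≤ 1 := fun ω x =>
    (measure_mono fun y hy => hy.2.symm).trans (hm.measure_singleton_le_one ω (H ω x))
  refine hR.ae_measure_in_le_one hX hm hκ hI hout ?_
  filter_upwards [hmaps, ae_measure_preimage_lt_top hX hm hκ hI hH] with ω hf hfin y hy
  by_cases hyp : ∀ n, κ ω {z | (H ω)^[n] z = y} ≠ 0
  · refine (hout ω y).trans ?_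
    obtain ⟨x, hxy, hx⟩ := ((hm.isPrimeval_iff hf hH ⟨y, hy⟩).2 hyp).exists_isPrimeval_apply_eq
      (hm.finite_preimage hf hH hfin)
    exact hm.one_le_measure ω
      (show (x : X) ∈ {x | (∀ n, κ ω {z | (H ω)^[n] z = x} ≠ 0) ∧ H ω x = y} from
        ⟨(hm.isPrimeval_iff hf hH x).1 hx, congrArg Subtype.val hxy⟩) x.2
  -- A point that is not primeval sends nothing, so the inequality is trivial there.
  · refine le_of_eq_of_le ?_ zero_le
    refine (congrArg (κ ω) ?_).trans measure_empty
    exact Set.eq_empty_of_forall_notMem fun x hx => hyp hx.1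

/-- Almost surely, a flow-adapted point-shift satisfies the consequences of mass transport. -/
theorem ae_hasMassTransportProperties (hX : IsUnimodularGroup X)
    (hm : IsSimplePointProcess κ) (hκ : IsFlowAdapted κ) (hI : HasFiniteNonzeroIntensity P κ)
    (hH : IsEquivariantMap H)
    (hmaps : ∀ᵐ ω ∂P, Set.MapsTo (H ω) (pointsOf (κ ω)) (pointsOf (κ ω))) :
    ∀ᵐ ω ∂P, ∃ hf : Set.MapsTo (H ω) (pointsOf (κ ω)) (pointsOf (κ ω)),
      HasMassTransportProperties (hf.restrict (H ω) (pointsOf (κ ω)) (pointsOf (κ ω))) := by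
  have := hm.isSFiniteKernel
  have hcomp := hH.isInvariantRelation_sameComponent
  have hfoil := hH.isInvariantRelation_sameFoil
  have hper := hH.isInvariantProperty_periodic
  have hlast := hH.isInvariantProperty_lastFinite hκ
  have hyoung := hH.isInvariantProperty_youngestFinite hκ
  have hprim := hH.isInvariantProperty_primeval hκ
  have hclass : ∀ {D : Ω → X → Prop}, IsInvariantProperty D → _ := fun {D} hD =>
    ae_measure_class_lt_top (P := P) hX hm hκ hI hcomp (fun _ _ _ => SameComponent.symm)
      (fun _ _ _ _ => SameComponent.trans) hD
  filter_upwards [hmaps, ae_measure_preimage_lt_top hX hm hκ hI hH,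
    ae_measure_primeval_preimage_le_one hX hm hκ hI hH hmaps, hclass hper, hclass hlast,
    hclass hyoung, ae_measure_class_lt_top (P := P) hX hm hκ hI hfoil (fun _ _ _ => SameFoil.symm)
      (fun _ _ _ _ => SameFoil.trans) hprim] with ω hf h1 h2 h3 h4 h5 h6
  have hcm := hcomp.measurableSet_section ω
  have hcr := sameComponent_restrict_iff hf
  refine ⟨hf, ⟨hm.finite_preimage hf hH h1,
    hm.finite_class hcm (hper.measurableSet_section ω) hcr (mem_periodicPts_restrict_iff hf) h3,
    hm.finite_class hcm (hlast.measurableSet_section ω) hcr (hm.inLastFiniteFoil_iff hf hH) h4,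
    hm.finite_class hcm (hyoung.measurableSet_section ω) hcr (hm.inYoungestFiniteFoil_iff hf hH) h5,
    ?_,
    hm.finite_class (hfoil.measurableSet_section ω) (hprim.measurableSet_section ω)
      (sameFoil_restrict_iff hf) (hm.isPrimeval_iff hf hH) h6⟩⟩
  intro x y hx hy hxy
  have hR := ((IsInvariantRelation.of_left hprim).and
    (hH.isInvariantRelation_iterate_eq 1)).measurableSet_section ω (H ω y)
  exact Subtype.ext (hm.eq_of_measure_le_one ω hR (h2 (H ω y) (hf y.2))
    ⟨(hm.isPrimeval_iff hf hH x).1 hx, congrArg Subtype.val hxy⟩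
    ⟨(hm.isPrimeval_iff hf hH y).1 hy, rfl⟩ x.2 y.2)

end AlmostSure

end PointShifts

theorem mainTheorem1 {X Ω : Type*}
    [Group X] [TopologicalSpace X] [IsTopologicalGroup X] [LocallyCompactSpace X]
    [SecondCountableTopology X] [T2Space X] [MeasurableSpace X] [BorelSpace X]
    (hX : IsUnimodularGroup X)
    [MeasurableSpace Ω] (P : Measure Ω) [IsProbabilityMeasure P]
    [MulAction X Ω] [MeasurableSMul₂ X Ω] [SMulInvariantMeasure X Ω P]
    (m : Ω → Measure X) (hm : IsSimplePointProcess m) (hmθ : IsFlowAdapted m)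
    (hmI : HasFiniteNonzeroIntensity P m)
    (H : Ω → X → X) (hH : IsFlowAdaptedPointShift P m H) :
    ∀ᵐ ω ∂P, ∀ C : FunctionalComponent (pointsOf (m ω)) (H ω),
      (IsClassFF (pointsOf (m ω)) (H ω) C ∨ IsClassIF (pointsOf (m ω)) (H ω) C ∨
        IsClassII (pointsOf (m ω)) (H ω) C) ∧
      (IsClassFF (pointsOf (m ω)) (H ω) C → StructureFF (pointsOf (m ω)) (H ω) C) ∧
      (IsClassIF (pointsOf (m ω)) (H ω) C → StructureIF (pointsOf (m ω)) (H ω) C) ∧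
      (IsClassII (pointsOf (m ω)) (H ω) C → StructureII (pointsOf (m ω)) (H ω) C) := by
  have h := ae_hasMassTransportProperties (κ := ⟨m, hm.measurable⟩) (P := P) hX hm hmθ hmI
    hH.isEquivariantMap hH.mapsTo
  filter_upwards [h] with ω ⟨hf, hg⟩ C
  exact hg.classification hf C
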